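/- **Setting.** There are $n\ge 2$ agents $1,\dots,n$ and a finite set $M$ of $m$ items. A valuation $f$ assigns a real number to every $S\subseteq M$. It is *submodular dichotomous* (equivalently, a matroid rank function) if $f(\emptyset)=0$, $f$ is non-decreasing, every marginal $f(S\cup\{a\})-f(S)$ is $0$ or $1$, and $f(S\cup\{a\})-f(S)\ge f(T\cup\{a\})-f(T)$ whenever $S\subseteq T$; it is *additive* if $f(S)+f(T)=f(S\cup T)$ for disjoint $S,T$. An allocation $A=(A_1,\dots,A_n)$ consists of pairwise disjoint subsets of $M$ (items may stay unallocated); it is *non-redundant* for $f=(f_1,\dots,f_n)$ if $f_i(A_i\setminus\{a\})<f_i(A_i)$ for all $i$ and all $a\in A_i$. It is *Lorenz dominating* if, for every allocation $B$ and every $k\le n$, the sum of the $k$ smallest of the utilities $f_i(A_i)$ is at least the sum of the $k$ smallest of the utilities $f_i(B_i)$. **The prioritized egalitarian (PE) mechanism.** Fix a priority order in which agent $i$ has position $\sigma(i)\in\{1,\dots,n\}$ (position $1$ is the highest priority). Every agent reports a valuation; a report that is not submodular dichotomous is replaced by the zero function. Add auxiliary items $a_1,\dots,a_n$, and put $f_i'(S)=f_i(S\cap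 M)+\frac{\sigma(i)}{n^2}\,|S\cap\{a_i\}|$, where $f_1,\dots,f_n$ are the (replaced) reports. A PE mechanism maps the reports to an allocation that is non-redundant for $f$ and is obtained by removing the auxiliary items from an allocation of $M\cup\{a_1,\dots,a_n\}$ that is Lorenz dominating for $f'=(f'_1,\dots,f'_n)$. **Theorem.** For all $n\ge2$, $m$ and every priority order $\sigma$, a PE mechanism exists, and every PE mechanism has the following properties. 1. It is truthful: for every agent with a submodular dichotomous valuation, and whatever the other agents report, reporting her true valuation maximizes the value that she receives. 2. If all agents have submodular dichotomous valuations $f$ and report them truthfully, then the output $A$ is non-redundant and welfare maximizing (it maximizes $\sum_i f_i(A_i)$). 3. In this case $A$ is also Lorenz dominating for $f$; lex-min (its vector of utilities, sorted increasingly, is lexicographically largest); min-square (it minimizes $\sum_i f_i(A_i)^2$ among welfare maximizing allocations); it maximizes the Nash social welfare $\prod_i f_i(A_i)$; and it is EFX (for all $i,j$, either $f_i(A_i)\ge f_i(A_j)$, or $f_i(A_i)\ge f_i(A_j\setminus\{e\})$ for every $e\in A_j$), and hence EF1 (the same with "for some $e\in A_j$"). If moreover all valuations $f_i$ are additive, then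 $A$ is maximin fair: for every $i$, $f_i(A_i)$ is at least the maximum, over all partitions of $M$ into $n$ (possibly empty) bundles, of the least value $f_i$ of a bundle. 4. PE can be implemented in polynomial time for succinctly represented valuations. That is, there is a family of PE mechanisms, one for each $n\ge 2$, $m$ and $\sigma$, such that for every succinct representation of valuations a single program, given $m$, $\sigma$ and the $n$ reported representations, computes the mechanism's allocation in time polynomial in $n$, $m$ and the total size of the representations. A representation is *succinct* if the value of a represented submodular dichotomous valuation on a given set of items can be computed in polynomial time from the representation, and if it can be verified in polynomial time whether a given representation is that of a submodular dichotomous valuation. -/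

import Mathlib

noncomputable section

namespace PrioritizedEgalitarian

/-! ### Valuations -/

/-- A (reported) valuation: a real value for every set of items.  Reports are not restricted;
the laws of a valuation are part of the predicates below. -/
abbrev Valuation (α : Type*) := Finset α → ℝ

/-- A submodular dichotomous valuation (equivalently, a matroid rank function): normalized,
non-decreasing, all marginals are `0` or `1`, and marginals are non-increasing. -/
structure IsSubmodularDichotomous {α : Type*} [DecidableEq α] (f : Valuation α) : Prop where
  normalized : f ∅ = 0
  monotone : ∀ S T : Finset α, S ⊆ T → f S ≤ f T
  dichotomous : ∀ (S : Finset α) (a : α), f (insert a S) - f S = 0 ∨ f (insert a S) - f S = 1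
  submodular : ∀ (S T : Finset α) (a : α), S ⊆ T →
    f (insert a T) - f T ≤ f (insert a S) - f S

/-- Additivity on disjoint sets. -/
def IsAdditive {α : Type*} [DecidableEq α] (f : Valuation α) : Prop :=
  ∀ S T : Finset α, Disjoint S T → f S + f T = f (S ∪ T)

/-! ### Allocations -/

/-- An allocation of items of `α` to `n` agents: pairwise disjoint bundles; items may stay
unallocated. -/
structure Allocation (n : ℕ) (α : Type*) where
  bundle : Fin n → Finset α
  disjoint : ∀ i j : Fin n, i ≠ j → Disjoint (bundle i) (bundle j)

/-- The utility vector of an allocation. -/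
def utility {n : ℕ} {α : Type*} (f : Fin n → Valuation α) (A : Allocation n α) : Fin n → ℝ :=
  fun i => f i (A.bundle i)

/-- The entries of the utility vector, sorted from smallest to largest. -/
def sortedUtility {n : ℕ} {α : Type*} (f : Fin n → Valuation α) (A : Allocation n α) :
    Fin n → ℝ :=
  utility f A ∘ Tuple.sort (utility f A)

/-- The welfare of an allocation. -/
def welfare {n : ℕ} {α : Type*} (f : Fin n → Valuation α) (A : Allocation n α) : ℝ :=
  ∑ i, utility f A i

def IsWelfareMaximizing {n : ℕ} {α : Type*} (f : Fin n → Valuation α) (A : Allocation n α) :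
    Prop :=
  ∀ B : Allocation n α, welfare f B ≤ welfare f A

/-- No agent holds an item whose removal would leave her value unchanged. -/
def IsNonRedundant {n : ℕ} {α : Type*} [DecidableEq α] (f : Fin n → Valuation α)
    (A : Allocation n α) : Prop :=
  ∀ i, ∀ a ∈ A.bundle i, f i ((A.bundle i).erase a) < f i (A.bundle i)

/-! ### Fairness -/

/-- Lorenz domination of sorted vectors: every prefix sum of `s` is at least that of `t`. -/
def LorenzGE {n : ℕ} (s t : Fin n → ℝ) : Prop :=
  ∀ k : Fin n, ∑ j ∈ Finset.Iic k, t j ≤ ∑ j ∈ Finset.Iic k, s j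

def IsLorenzDominating {n : ℕ} {α : Type*} (f : Fin n → Valuation α) (A : Allocation n α) :
    Prop :=
  ∀ B : Allocation n α, LorenzGE (sortedUtility f A) (sortedUtility f B)

/-- The strict lex-min order on sorted vectors. -/
def LexMinGT {n : ℕ} (s t : Fin n → ℝ) : Prop :=
  ∃ k : Fin n, t k < s k ∧ ∀ j < k, s j = t j

def IsLexMin {n : ℕ} {α : Type*} (f : Fin n → Valuation α) (A : Allocation n α) : Prop :=
  ∀ B : Allocation n α, LexMinGT (sortedUtility f A) (sortedUtility f B) ∨
    sortedUtility f A = sortedUtility f B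

/-- Welfare maximizing, with the least sum of squared utilities among welfare maximizing
allocations. -/
def IsMinSquare {n : ℕ} {α : Type*} (f : Fin n → Valuation α) (A : Allocation n α) : Prop :=
  IsWelfareMaximizing f A ∧
    ∀ B : Allocation n α, IsWelfareMaximizing f B →
      ∑ i, utility f A i ^ 2 ≤ ∑ i, utility f B i ^ 2

/-- Maximal Nash social welfare (product of utilities). -/
def IsNSWMaximizing {n : ℕ} {α : Type*} (f : Fin n → Valuation α) (A : Allocation n α) : Prop :=
  ∀ B : Allocation n α, ∏ i, utility f B i ≤ ∏ i, utility f A i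

/-- Envy free up to one good. -/
def IsEF1 {n : ℕ} {α : Type*} [DecidableEq α] (f : Fin n → Valuation α) (A : Allocation n α) :
    Prop :=
  ∀ i j, f i (A.bundle j) ≤ f i (A.bundle i) ∨
    ∃ a ∈ A.bundle j, f i ((A.bundle j).erase a) ≤ f i (A.bundle i)

/-- Envy free up to any good. -/
def IsEFX {n : ℕ} {α : Type*} [DecidableEq α] (f : Fin n → Valuation α) (A : Allocation n α) :
    Prop :=
  ∀ i j, f i (A.bundle j) ≤ f i (A.bundle i) ∨
    ∀ a ∈ A.bundle j, f i ((A.bundle j).erase a) ≤ f i (A.bundle i)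

/-- The maximin share for `n` agents: the maximum over all partitions of the items into `n`
(possibly empty) bundles, given by maps `P` from items to bundle numbers, of the minimum value
of a bundle. -/
def maximinShare (n : ℕ) {α : Type*} [Fintype α] (f : Valuation α) : ℝ :=
  ⨆ P : α → Fin n, ⨅ j : Fin n, f (Finset.univ.filter fun a => P a = j)

def IsMaximinFair {n : ℕ} {α : Type*} [Fintype α] (f : Fin n → Valuation α)
    (A : Allocation n α) : Prop :=
  ∀ i, maximinShare n (f i) ≤ f i (A.bundle i)

/-! ### Mechanisms and the prioritized egalitarian mechanism -/

/-- A deterministic mechanism maps reported valuations to an allocation. -/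
abbrev Mechanism (n : ℕ) (α : Type*) := (Fin n → Valuation α) → Allocation n α

/-- Reporting the true valuation is a dominant strategy for every agent whose valuation is
submodular dichotomous; the reports `r` of the others and the deviation `g` are arbitrary. -/
def IsTruthful {n : ℕ} {α : Type*} [DecidableEq α] (M : Mechanism n α) : Prop :=
  ∀ (i : Fin n) (f : Valuation α), IsSubmodularDichotomous f → ∀ (r : Fin n → Valuation α) (g : Valuation α),
    f ((M (Function.update r i g)).bundle i) ≤ f ((M (Function.update r i f)).bundle i)

/-- The valuations extended to one auxiliary item `Sum.inr i` for every agent `i`, which adds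
`(σ i + 1) / n ^ 2` to the value of agent `i` and nothing to that of the others.  Here `σ i`
(counted from `0`) is the position of agent `i` in the priority order, `0` being the highest
priority. -/
def augment {n : ℕ} {α : Type*} [DecidableEq α] (σ : Equiv.Perm (Fin n))
    (f : Fin n → Valuation α) : Fin n → Valuation (α ⊕ Fin n) :=
  fun i S => f i S.toLeft +
    if Sum.inr i ∈ S then (((σ i : ℕ) : ℝ) + 1) / (n : ℝ) ^ 2 else 0

/-- A prioritized egalitarian allocation: a non-redundant allocation obtained by removing the
auxiliary items from an allocation that is Lorenz dominating for the augmented valuations. -/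
def IsPEAllocation {n : ℕ} {α : Type*} [DecidableEq α] (σ : Equiv.Perm (Fin n))
    (f : Fin n → Valuation α) (A : Allocation n α) : Prop :=
  IsNonRedundant f A ∧
    ∃ A' : Allocation n (α ⊕ Fin n), IsLorenzDominating (augment σ f) A' ∧
      ∀ i, A.bundle i = (A'.bundle i).toLeft

open Classical in
/-- Illegal reports are replaced by the zero valuation. -/
def legalize {α : Type*} [DecidableEq α] (f : Valuation α) : Valuation α :=
  if IsSubmodularDichotomous f then f else fun _ => 0

/-- `M` is a prioritized egalitarian mechanism with priority order `σ`. -/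
def IsPEMechanism {n : ℕ} {α : Type*} [DecidableEq α] (σ : Equiv.Perm (Fin n))
    (M : Mechanism n α) : Prop :=
  ∀ r : Fin n → Valuation α, IsPEAllocation σ (fun i => legalize (r i)) (M r)

/-! ### A machine model: while programs on binary trees, with their running time -/

/-- The data on which programs work. -/
inductive BinTree where
  | nil : BinTree
  | cons : BinTree → BinTree → BinTree

/-- The number of nodes of a tree. -/
def BinTree.size : BinTree → ℕ
  | .nil => 1
  | .cons a b => a.size + b.size + 1

/-- The left component. -/
def BinTree.left : BinTree → BinTree
  | .nil => .nil
  | .cons a _ => a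

/-- The right component. -/
def BinTree.right : BinTree → BinTree
  | .nil => .nil
  | .cons _ b => b

/-- Programs; each transforms one tree into another.  `comp p q` runs `q` first, `cond c p q` runs
`p` if the result of the test `c` is not `nil` and `q` otherwise, and `loop c p` applies `p` for as
long as the result of `c` is not `nil`. -/
inductive Prog where
  | skip : Prog
  | nil : Prog
  | left : Prog
  | right : Prog
  | pair : Prog → Prog → Prog
  | comp : Prog → Prog → Prog
  | cond : Prog → Prog → Prog → Prog
  | loop : Prog → Prog → Prog

/-- `Run p x y t`: on input `x` the program `p` halts with output `y` in time `t`.  An elementary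
operation is charged the size of its whole argument plus one, so that the time spent is always at
least the size of every tree that occurs in the run. -/
inductive Run : Prog → BinTree → BinTree → ℕ → Prop where
  | skip (x : BinTree) : Run .skip x x (x.size + 1)
  | nil (x : BinTree) : Run .nil x .nil (x.size + 1)
  | left (x : BinTree) : Run .left x x.left (x.size + 1)
  | right (x : BinTree) : Run .right x x.right (x.size + 1)
  | pair {p q : Prog} {x y z : BinTree} {s t : ℕ} (hp : Run p x y s) (hq : Run q x z t) :
      Run (.pair p q) x (.cons y z) (s + t + 1)
  | comp {p q : Prog} {x y z : BinTree} {s t : ℕ} (hq : Run q x y s) (hp : Run p y z t) :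
      Run (.comp p q) x z (s + t + 1)
  | cond_true {c p q : Prog} {x a b y : BinTree} {s t : ℕ} (hc : Run c x (.cons a b) s)
      (hp : Run p x y t) : Run (.cond c p q) x y (s + t + 1)
  | cond_false {c p q : Prog} {x y : BinTree} {s t : ℕ} (hc : Run c x .nil s)
      (hq : Run q x y t) : Run (.cond c p q) x y (s + t + 1)
  | loop_stop {c p : Prog} {x : BinTree} {s : ℕ} (hc : Run c x .nil s) :
      Run (.loop c p) x x (s + 1)
  | loop_step {c p : Prog} {x a b y z : BinTree} {s t u : ℕ} (hc : Run c x (.cons a b) s)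
      (hp : Run p x y t) (hl : Run (.loop c p) y z u) : Run (.loop c p) x z (s + t + u + 1)

/-- One program solves all instances `i` of a problem (given `input i`, it outputs `output i`), in
time polynomial in the size of the input. -/
def SolvableInPolyTime {ι : Type*} (input output : ι → BinTree) : Prop :=
  ∃ (p : Prog) (q : Polynomial ℕ), ∀ i, ∃ t, Run p (input i) (output i) t ∧
    t ≤ q.eval (input i).size

/-- Natural numbers in unary. -/
def encodeNat : ℕ → BinTree
  | 0 => .nil
  | k + 1 => .cons .nil (encodeNat k)

def encodeList : List BinTree → BinTree
  | [] => .nil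
  | x :: l => .cons x (encodeList l)

open Classical in
/-- Truth values, as the numbers `1` and `0`. -/
def encodeProp (P : Prop) : BinTree := encodeNat (if P then 1 else 0)

/-- A set of items, as the list of its membership bits. -/
def encodeItems {m : ℕ} (S : Finset (Fin m)) : BinTree :=
  encodeList (List.ofFn fun a => encodeProp (a ∈ S))

/-- An allocation, as the list of its bundles. -/
def encodeAllocation {n m : ℕ} (A : Allocation n (Fin m)) : BinTree :=
  encodeList (List.ofFn fun i => encodeItems (A.bundle i))

/-- An input of the mechanism: the number of items, the priority positions of the agents, and the
representations that the agents report. -/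
def encodeInstance {n : ℕ} (m : ℕ) (σ : Equiv.Perm (Fin n)) (d : Fin n → BinTree) : BinTree :=
  .cons (encodeNat m)
    (.cons (encodeList (List.ofFn fun i => encodeNat (σ i))) (encodeList (List.ofFn d)))

/-- A way to represent valuations: `R m d` is the function on sets of `m` items that `d` stands
for (a meaningless `d` stands for some function that is not a matroid rank function). -/
abbrev Representation := (m : ℕ) → BinTree → Valuation (Fin m)

/-- The representation is succinct: given `m`, a representation `d` of a submodular dichotomous
valuation and a set `S`, its value (then a natural number) on `S` can be computed in polynomial
time, and it can be verified in polynomial time whether a given `d` represents a submodular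
dichotomous valuation. -/
def IsSuccinct (R : Representation) : Prop :=
  SolvableInPolyTime
      (ι := {x : (m : ℕ) × (BinTree × Finset (Fin m)) // IsSubmodularDichotomous (R x.1 x.2.1)})
      (fun x => .cons (encodeNat x.1.1) (.cons x.1.2.1 (encodeItems x.1.2.2)))
      (fun x => encodeNat ⌊R x.1.1 x.1.2.1 x.1.2.2⌋₊) ∧
    SolvableInPolyTime (ι := ℕ × BinTree)
      (fun x => .cons (encodeNat x.1) x.2)
      (fun x => encodeProp (IsSubmodularDichotomous (R x.1 x.2)))

/-- Given represented reports, a family of mechanisms (one for every number `n ≥ 2` of agents,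
number `m` of items, and priority order `σ`) is computed by one program, in time polynomial in the
size of the input (hence in `n`, `m` and the sizes of the representations). -/
def IsPolyTimeMechanism (R : Representation)
    (M : (n m : ℕ) → Equiv.Perm (Fin n) → Mechanism n (Fin m)) : Prop :=
  SolvableInPolyTime
    (ι := (n : {n : ℕ // 2 ≤ n}) × ℕ × Equiv.Perm (Fin n.1) × (Fin n.1 → BinTree))
    (fun x => encodeInstance x.2.1 x.2.2.1 x.2.2.2)
    (fun x => encodeAllocation (M x.1.1 x.2.1 x.2.2.1 fun i => R x.2.1 (x.2.2.2 i)))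

end PrioritizedEgalitarian

end

/-! The utility vectors of allocations form the integral points of a polymatroid: a vector `x` can be
attained only if it satisfies all rank inequalities `x(J) ≤ ∑ j ∈ J, r j S + |Sᶜ|`
(`isBounded_of_bundles`), and a set `J` of agents is called tight if one of them is an equality.
Tight sets can be uncrossed (`rank_uncross`), in particular they are closed under unions.

Everything rests on the egalitarian vector (`IsEgalitarian`): every agent `i` lies in a tight set all
of whose members received their last unit before `i` got stuck.  By taking unions of these tight sets,
the egalitarian vector has, up to every level, at least as many units as any other utility vector
(`card_units_le`), so it maximizes all sums of unit weights that decrease with the level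
(`sum_weights_le`).  Suitable weights show Lorenz domination, for the given valuations as well as for
the augmented ones, and the maximality of welfare and of Nash welfare and the minimality of the sum of
squares.  The auxiliary items make the fractional parts of the utilities distinct, so that all
prioritized egalitarian allocations have the egalitarian vector as their utility vector
(`IsPEAllocation.utility_eq`).  EFX follows from the minimality of the sum of squares, the maximin
share from EFX, and truthfulness by uncrossing tight sets under the true and the untrue report
(`IsEgalitarian.le_of_update`).

The egalitarian vector is computed by augmenting the utility of one agent at a time, in rounds in the
order of priority.  An augmentation is an auction, which needs neither exchange graphs nor shortest
paths: the agent who lacks an item takes the cheapest item that raises her value, its price goes up by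
one, and its previous owner is the next to buy.  Each agent's items stay at most one unit more
expensive than the items for which they could be exchanged (`AuctionInv`).  The auction succeeds when
an unallocated item is taken.  If it gets stuck, then the prices have a gap, and the agents whose
bundles exhaust the items below the gap form a tight set (`AuctionInv.exists_isTight`).

For the running time, `SolvableInPolyTime` is shown to be closed under the usual operations, in
particular under loops with states of polynomial size (`SolvableInPolyTime.countdown`); the algorithm
is then a composition of such operations. -/

noncomputable section

namespace PrioritizedEgalitarian

/-! ### Matroid rank functions with natural values -/

/-- A matroid rank function with values in `ℕ`. -/
structure IsRank {α : Type*} [DecidableEq α] (r : Finset α → ℕ) : Prop where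
  empty : r ∅ = 0
  mono : ∀ S T : Finset α, S ⊆ T → r S ≤ r T
  insert_le : ∀ (S : Finset α) (a : α), r (insert a S) ≤ r S + 1
  submod : ∀ (S T : Finset α) (a : α), S ⊆ T → r (insert a T) + r S ≤ r (insert a S) + r T

/-- Independent sets of the matroid with rank function `r`. -/
def Indep {α : Type*} (r : Finset α → ℕ) (S : Finset α) : Prop := r S = S.card

section Rank

variable {α : Type*} [DecidableEq α] {r : Finset α → ℕ}

lemma IsRank.union_le (hr : IsRank r) (S T : Finset α) : r (S ∪ T) ≤ r S + T.card := by
  induction T using Finset.induction_on with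
  | empty => simp
  | insert a T ha ih =>
    rw [Finset.union_insert, Finset.card_insert_of_notMem ha]
    have := hr.insert_le (S ∪ T) a
    omega

lemma IsRank.le_card (hr : IsRank r) (S : Finset α) : r S ≤ S.card := by
  have := hr.union_le ∅ S
  rwa [hr.empty, Finset.empty_union, zero_add] at this

lemma IsRank.union_add_le (hr : IsRank r) {S T : Finset α} (hST : S ⊆ T) (X : Finset α) :
    r (T ∪ X) + r S ≤ r (S ∪ X) + r T := by
  induction X using Finset.induction_on with
  | empty => simp [add_comm]
  | insert a X _ ih =>
    rw [Finset.union_insert, Finset.union_insert]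
    have := hr.submod (S ∪ X) (T ∪ X) a (Finset.union_subset_union_left hST)
    omega

/-- The lattice form of submodularity. -/
lemma IsRank.union_add_inter_le (hr : IsRank r) (S T : Finset α) :
    r (S ∪ T) + r (S ∩ T) ≤ r S + r T := by
  have := hr.union_add_le (Finset.inter_subset_left : S ∩ T ⊆ S) T
  rw [Finset.union_eq_right.2 (Finset.inter_subset_right : S ∩ T ⊆ T)] at this
  omega

lemma IsRank.indep_subset (hr : IsRank r) {S T : Finset α} (hT : Indep r T) (h : S ⊆ T) :
    Indep r S := by
  have h1 := hr.union_le S (T \ S)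
  rw [Finset.union_sdiff_of_subset h, hT, Finset.card_sdiff_of_subset h] at h1
  have := hr.le_card S
  have := Finset.card_le_card h
  unfold Indep
  omega

/-- Augmentation: a set of larger rank contains an element that raises the rank. -/
lemma IsRank.exists_lt_insert (hr : IsRank r) {S T : Finset α} (h : r S < r T) :
    ∃ b ∈ T, r S < r (insert b S) := by
  by_contra! hc
  have key : ∀ X ⊆ T, r (S ∪ X) ≤ r S := by
    intro X
    induction X using Finset.induction_on with
    | empty => simp
    | insert a X _ ih =>
      intro hX
      rw [Finset.union_insert]
      have h1 := ih (fun x hx => hX (Finset.mem_insert_of_mem hx))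
      have h2 := hr.submod S (S ∪ X) a Finset.subset_union_left
      have h3 := hc a (hX (Finset.mem_insert_self a X))
      omega
  have h1 := key T subset_rfl
  have h2 := hr.mono T (S ∪ T) Finset.subset_union_right
  omega

lemma IsRank.notMem_of_lt_insert {S : Finset α} {b : α} (h : r S < r (insert b S)) : b ∉ S := by
  intro hb
  rw [Finset.insert_eq_of_mem hb] at h
  exact lt_irrefl _ h

lemma IsRank.indep_insert (hr : IsRank r) {S : Finset α} {b : α} (hS : Indep r S)
    (h : r S < r (insert b S)) : Indep r (insert b S) := by
  have := hr.insert_le S b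
  unfold Indep at *
  rw [Finset.card_insert_of_notMem (IsRank.notMem_of_lt_insert h)]
  omega

lemma IsRank.lt_insert (hr : IsRank r) {S : Finset α} {b : α} (hb : b ∉ S)
    (h : Indep r (insert b S)) : r S < r (insert b S) := by
  have := hr.indep_subset h (Finset.subset_insert b S)
  unfold Indep at *
  rw [h, this, Finset.card_insert_of_notMem hb]
  omega

lemma IsRank.exists_indep_insert (hr : IsRank r) {S T : Finset α} (hS : Indep r S)
    (hT : Indep r T) (h : S.card < T.card) : ∃ b ∈ T, b ∉ S ∧ Indep r (insert b S) := by
  obtain ⟨b, hb, hlt⟩ := hr.exists_lt_insert (S := S) (T := T) (by rw [hS, hT]; exact h)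
  exact ⟨b, hb, IsRank.notMem_of_lt_insert hlt, hr.indep_insert hS hlt⟩

/-- An independent set extends to a basis of any set containing it. -/
lemma IsRank.exists_basis (hr : IsRank r) {X Z : Finset α} (hX : Indep r X) (hXZ : X ⊆ Z) :
    ∃ Y, X ⊆ Y ∧ Y ⊆ Z ∧ Indep r Y ∧ Y.card = r Z := by
  induction hk : r Z - r X generalizing X with
  | zero =>
    refine ⟨X, subset_rfl, hXZ, hX, ?_⟩
    have := hr.mono X Z hXZ
    unfold Indep at hX
    omega
  | succ k ih =>
    obtain ⟨b, hb, hlt⟩ := hr.exists_lt_insert (S := X) (T := Z) (by omega)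
    have := hr.insert_le X b
    obtain ⟨Y, h1, h2, h3, h4⟩ := ih (X := insert b X) (hr.indep_insert hX hlt)
      (Finset.insert_subset hb hXZ) (by omega)
    exact ⟨Y, (Finset.subset_insert b X).trans h1, h2, h3, h4⟩

/-- If `c` extends the part of the independent set `A` inside `S` but not `A` itself, then `c` can
be exchanged for an element of `A` outside `S`. -/
lemma IsRank.exists_exchange (hr : IsRank r) {A S : Finset α} {c : α} (hA : Indep r A)
    (h : Indep r (insert c (A ∩ S))) (hc : ¬ Indep r (insert c A)) :
    ∃ a ∈ A, a ∉ S ∧ Indep r (insert c (A.erase a)) := by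
  obtain ⟨Y, h1, h2, h3, h4⟩ := hr.exists_basis h
    (Finset.insert_subset_insert c (Finset.inter_subset_left : A ∩ S ⊆ A))
  have hne : Y ≠ insert c A := fun e => hc (e ▸ h3)
  obtain ⟨a, ha, haY⟩ := Finset.exists_of_ssubset (h2.ssubset_of_ne hne)
  have hac : a ≠ c := fun e => haY (h1 (e ▸ Finset.mem_insert_self _ _))
  have haA : a ∈ A := (Finset.mem_insert.1 ha).resolve_left hac
  refine ⟨a, haA, fun haS => haY (h1 (by simp [haA, haS])), ?_⟩
  have hsub : Y ⊆ insert c (A.erase a) := by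
    intro y hy
    rcases Finset.mem_insert.1 (h2 hy) with e | e
    · simp [e]
    · have : y ≠ a := fun e' => haY (e' ▸ hy)
      simp [e, this]
  have hcard : (insert c (A.erase a)).card ≤ Y.card := by
    have e1 := Finset.card_insert_le c (A.erase a)
    have e2 := Finset.card_erase_add_one haA
    have e3 := hr.mono A (insert c A) (Finset.subset_insert c A)
    unfold Indep at hA
    omega
  rw [← Finset.eq_of_subset_of_card_le hsub hcard]
  exact h3

/-- A set all of whose elements matter is independent. -/
lemma IsRank.indep_of_erase_lt (hr : IsRank r) {A : Finset α}
    (h : ∀ a ∈ A, r (A.erase a) < r A) : Indep r A := by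
  obtain ⟨Y, -, h2, h3, h4⟩ := hr.exists_basis (X := ∅) (Z := A)
    (by simp [Indep, hr.empty]) (Finset.empty_subset A)
  by_cases hY : Y = A
  · exact hY ▸ h3
  · obtain ⟨a, ha, haY⟩ := Finset.exists_of_ssubset (h2.ssubset_of_ne hY)
    have h5 := hr.mono Y (A.erase a) (Finset.subset_erase.2 ⟨h2, haY⟩)
    have h6 := h a ha
    unfold Indep at h3
    omega

end Rank

/-! ### Utility vectors and tight sets of agents -/

section Tight

variable {n : ℕ} {α : Type*} [DecidableEq α] [Fintype α]

/-- The vector `x` satisfies the rank inequalities that every utility vector satisfies: whatever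
the agents of `J` receive from `S` is at most the sum of their ranks of `S`, and the items outside
`S` add at most one each. -/
def IsBounded (r : Fin n → Finset α → ℕ) (x : Fin n → ℕ) : Prop :=
  ∀ (J : Finset (Fin n)) (S : Finset α), ∑ j ∈ J, x j ≤ ∑ j ∈ J, r j S + Sᶜ.card

/-- The agents of `J` together receive as much as they can: some rank inequality for `J` holds with
equality. -/
def IsTight (r : Fin n → Finset α → ℕ) (x : Fin n → ℕ) (J : Finset (Fin n)) : Prop :=
  ∃ S : Finset α, ∑ j ∈ J, r j S + Sᶜ.card ≤ ∑ j ∈ J, x j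

variable {r : Fin n → Finset α → ℕ} {x y : Fin n → ℕ}

lemma isBounded_of_bundles (hr : ∀ i, IsRank (r i)) {B : Fin n → Finset α}
    (hB : ∀ i j, i ≠ j → Disjoint (B i) (B j)) : IsBounded r (fun i => r i (B i)) := by
  intro J S
  have h1 : ∀ j, r j (B j) ≤ r j S + (B j \ S).card := by
    intro j
    have e1 := (hr j).union_le (B j ∩ S) (B j \ S)
    rw [Finset.union_comm, Finset.sdiff_union_inter] at e1
    have e2 := (hr j).mono (B j ∩ S) S Finset.inter_subset_right
    omega
  have h2 : ∑ j ∈ J, (B j \ S).card ≤ Sᶜ.card := by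
    rw [← Finset.card_biUnion]
    · refine Finset.card_le_card fun a ha => ?_
      simp only [Finset.mem_biUnion, Finset.mem_sdiff] at ha
      obtain ⟨_, _, _, h⟩ := ha
      simpa using h
    · intro i _ j _ hij
      exact (hB i j hij).mono Finset.sdiff_subset Finset.sdiff_subset
  calc ∑ j ∈ J, r j (B j) ≤ ∑ j ∈ J, (r j S + (B j \ S).card) := Finset.sum_le_sum fun j _ => h1 j
    _ ≤ _ := by rw [Finset.sum_add_distrib]; omega

lemma IsTight.sum_le {J : Finset (Fin n)} (h : IsTight r x J) (hy : IsBounded r y) :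
    ∑ j ∈ J, y j ≤ ∑ j ∈ J, x j := by
  obtain ⟨S, hS⟩ := h
  exact (hy J S).trans hS

lemma IsTight.congr {J : Finset (Fin n)} (h : IsTight r x J) (hxy : ∀ j ∈ J, x j = y j) :
    IsTight r y J := by
  obtain ⟨S, hS⟩ := h
  exact ⟨S, by rwa [← Finset.sum_congr rfl hxy]⟩

/-- Uncrossing of the right hand sides of two rank inequalities. -/
lemma rank_uncross (hr : ∀ i, IsRank (r i)) (J T : Finset (Fin n)) (S U : Finset α) :
    (∑ j ∈ J ∪ T, r j (S ∩ U) + (S ∩ U)ᶜ.card) + (∑ j ∈ J ∩ T, r j (S ∪ U) + (S ∪ U)ᶜ.card) ≤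
      (∑ j ∈ J, r j S + Sᶜ.card) + (∑ j ∈ T, r j U + Uᶜ.card) := by
  have hc : (S ∩ U)ᶜ.card + (S ∪ U)ᶜ.card = Sᶜ.card + Uᶜ.card := by
    rw [Finset.compl_inter, Finset.compl_union, Finset.card_union_add_card_inter]
  have e1 : ∑ j ∈ J ∪ T, r j (S ∩ U) =
      ∑ j ∈ J \ T, r j (S ∩ U) + ∑ j ∈ T \ J, r j (S ∩ U) + ∑ j ∈ J ∩ T, r j (S ∩ U) := by
    rw [← Finset.sum_union disjoint_sdiff_sdiff, ← Finset.sum_union]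
    · congr 1; ext; simp; tauto
    · rw [Finset.disjoint_left]; intro a; simp; tauto
  have e2 : ∑ j ∈ J, r j S = ∑ j ∈ J \ T, r j S + ∑ j ∈ J ∩ T, r j S := by
    rw [← Finset.sum_union (Finset.disjoint_sdiff_inter J T), Finset.sdiff_union_inter]
  have e3 : ∑ j ∈ T, r j U = ∑ j ∈ T \ J, r j U + ∑ j ∈ J ∩ T, r j U := by
    rw [Finset.inter_comm, ← Finset.sum_union (Finset.disjoint_sdiff_inter T J),
      Finset.sdiff_union_inter]
  have i1 : ∑ j ∈ J \ T, r j (S ∩ U) ≤ ∑ j ∈ J \ T, r j S :=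
    Finset.sum_le_sum fun j _ => (hr j).mono _ _ Finset.inter_subset_left
  have i2 : ∑ j ∈ T \ J, r j (S ∩ U) ≤ ∑ j ∈ T \ J, r j U :=
    Finset.sum_le_sum fun j _ => (hr j).mono _ _ Finset.inter_subset_right
  have i3 : ∑ j ∈ J ∩ T, r j (S ∪ U) + ∑ j ∈ J ∩ T, r j (S ∩ U) ≤
      ∑ j ∈ J ∩ T, r j S + ∑ j ∈ J ∩ T, r j U := by
    rw [← Finset.sum_add_distrib, ← Finset.sum_add_distrib]
    exact Finset.sum_le_sum fun j _ => (hr j).union_add_inter_le S U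
  omega

/-- Uncrossing for tight sets of two different vectors. -/
lemma IsTight.uncross (hr : ∀ i, IsRank (r i)) (hx : IsBounded r x) (hy : IsBounded r y)
    {J T : Finset (Fin n)} (hJ : IsTight r x J) (hT : IsTight r y T) :
    ∑ j ∈ J ∪ T, y j + ∑ j ∈ J ∩ T, x j ≤ ∑ j ∈ J, x j + ∑ j ∈ T, y j := by
  obtain ⟨S, hS⟩ := hJ
  obtain ⟨U, hU⟩ := hT
  have h1 := rank_uncross hr J T S U
  have h2 := hy (J ∪ T) (S ∩ U)
  have h3 := hx (J ∩ T) (S ∪ U)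
  omega

lemma IsTight.union (hr : ∀ i, IsRank (r i)) (hx : IsBounded r x)
    {J T : Finset (Fin n)} (hJ : IsTight r x J) (hT : IsTight r x T) : IsTight r x (J ∪ T) := by
  obtain ⟨S, hS⟩ := hJ
  obtain ⟨U, hU⟩ := hT
  have h1 := rank_uncross hr J T S U
  have h2 := hx (J ∩ T) (S ∪ U)
  have h3 := Finset.sum_union_inter (s₁ := J) (s₂ := T) (f := x)
  exact ⟨S ∩ U, by omega⟩

lemma isTight_empty : IsTight r x ∅ := ⟨Finset.univ, by simp⟩

lemma IsTight.biUnion (hr : ∀ i, IsRank (r i)) (hx : IsBounded r x) {K : Finset (Fin n)}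
    {J : Fin n → Finset (Fin n)} (h : ∀ i ∈ K, IsTight r x (J i)) :
    IsTight r x (K.biUnion J) := by
  induction K using Finset.induction_on with
  | empty => exact isTight_empty
  | insert a K _ ih =>
    rw [Finset.biUnion_insert]
    exact (h a (Finset.mem_insert_self a K)).union hr hx
      (ih fun i hi => h i (Finset.mem_insert_of_mem hi))

/-! ### The egalitarian vector -/

/-- The vector that results from raising, one unit at a time, the entry of the agent who has the
least (in case of a tie: of highest priority) among those whose entry can still be raised.  The
entry of each agent `i` is final because `i` lies in a tight set, and all members `j` of that set
received their last unit before `i` was considered again. -/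
def IsEgalitarian (σ : Equiv.Perm (Fin n)) (r : Fin n → Finset α → ℕ) (x : Fin n → ℕ) : Prop :=
  IsBounded r x ∧ ∀ i, ∃ J : Finset (Fin n), i ∈ J ∧ IsTight r x J ∧
    ∀ j ∈ J, x j ≤ x i ∨ (x j = x i + 1 ∧ σ j < σ i)

/-- Unit number `t` of agent `i` has level `t + ε i`.  Up to every level `τ`, the egalitarian vector
has at least as many units as any other vector: the agents who got stuck up to level `τ` lie in a
tight set whose members have all their units up to that level, and the other agents have every
possible unit up to level `τ`. -/
lemma card_units_le (hr : ∀ i, IsRank (r i)) (hx : IsBounded r x) (ε : Fin n → ℝ)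
    (hP : ∀ i, ∃ J : Finset (Fin n), i ∈ J ∧ IsTight r x J ∧
      ∀ j ∈ J, (x j : ℝ) + ε j ≤ x i + ε i + 1) (hy : IsBounded r y) (τ : ℝ) :
    ∑ i, ((Finset.range (y i)).filter fun t : ℕ => (t : ℝ) + ε i ≤ τ).card ≤
      ∑ i, ((Finset.range (x i)).filter fun t : ℕ => (t : ℝ) + ε i ≤ τ).card := by
  choose J hiJ hJ hlev using hP
  set K := Finset.univ.filter fun i => (x i : ℝ) + ε i ≤ τ with hK
  have hU : IsTight r x (K.biUnion J) := IsTight.biUnion hr hx fun i _ => hJ i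
  rw [← Finset.sum_add_sum_compl (K.biUnion J),
    ← Finset.sum_add_sum_compl (K.biUnion J) (fun i => Finset.card _)]
  refine add_le_add ?_ (Finset.sum_le_sum fun i hi => Finset.card_le_card fun t ht => ?_)
  · calc _ ≤ ∑ i ∈ K.biUnion J, y i := Finset.sum_le_sum fun i _ =>
          (Finset.card_filter_le _ _).trans (by simp)
      _ ≤ ∑ i ∈ K.biUnion J, x i := hU.sum_le hy
      _ ≤ _ := Finset.sum_le_sum fun j hj => ?_
    rw [Finset.filter_true_of_mem, Finset.card_range]
    intro t ht
    obtain ⟨i, hi, hji⟩ := Finset.mem_biUnion.1 hj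
    have h1 := hlev i j hji
    have h2 : (x i : ℝ) + ε i ≤ τ := (Finset.mem_filter.1 hi).2
    have h3 : ((t + 1 : ℕ) : ℝ) ≤ x j := by exact_mod_cast Finset.mem_range.1 ht
    push_cast at h3
    linarith
  · simp only [Finset.mem_filter, Finset.mem_range] at ht ⊢
    refine ⟨?_, ht.2⟩
    have hi' : i ∉ K := fun h => Finset.mem_compl.1 hi (Finset.mem_biUnion.2 ⟨i, h, hiJ i⟩)
    have h4 : τ < (x i : ℝ) + ε i := by simpa [hK] using hi'
    have : (t : ℝ) < x i := by linarith [ht.2]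
    exact_mod_cast this

/-- The egalitarian vector maximizes every sum of unit weights that decrease with the level: by
Hall's theorem the units of `y` can be matched to units of `x` of no higher level. -/
lemma sum_weights_le (hr : ∀ i, IsRank (r i)) (hx : IsBounded r x) (ε : Fin n → ℝ)
    (hP : ∀ i, ∃ J : Finset (Fin n), i ∈ J ∧ IsTight r x J ∧
      ∀ j ∈ J, (x j : ℝ) + ε j ≤ x i + ε i + 1) (hy : IsBounded r y)
    (g : ℝ → ℝ) (hg : Antitone g) (hg0 : ∀ u, 0 ≤ g u) :
    ∑ i, ∑ t ∈ Finset.range (y i), g ((t : ℝ) + ε i) ≤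
      ∑ i, ∑ t ∈ Finset.range (x i), g ((t : ℝ) + ε i) := by
  set lev : (Σ _ : Fin n, ℕ) → ℝ := fun u => (u.2 : ℝ) + ε u.1 with hlev
  set X : Finset (Σ _ : Fin n, ℕ) := Finset.univ.sigma fun i => Finset.range (x i) with hX
  set Y : Finset (Σ _ : Fin n, ℕ) := Finset.univ.sigma fun i => Finset.range (y i) with hY
  have hcount : ∀ τ, (Y.filter fun u => lev u ≤ τ).card ≤ (X.filter fun u => lev u ≤ τ).card := by
    intro τ
    have hc : ∀ z : Fin n → ℕ,
        ((Finset.univ.sigma fun i => Finset.range (z i)).filter fun u => lev u ≤ τ).card =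
          ∑ i, ((Finset.range (z i)).filter fun t : ℕ => (t : ℝ) + ε i ≤ τ).card := by
      intro z
      rw [← Finset.card_sigma]
      congr 1
      ext u
      simp [hlev]
    rw [hX, hY, hc, hc]
    exact card_units_le hr hx ε hP hy τ
  obtain ⟨e, he, hmem⟩ := (Finset.all_card_le_biUnion_card_iff_exists_injective
    (fun u : Y => X.filter fun v => lev v ≤ lev u.1)).1 (by
      intro s
      rcases s.eq_empty_or_nonempty with rfl | hs
      · simp
      · obtain ⟨u, hu, hmax⟩ := Finset.exists_max_image s (fun u => lev u.1) hs
        calc s.card = (s.map (Function.Embedding.subtype _)).card := (Finset.card_map _).symm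
          _ ≤ (Y.filter fun v => lev v ≤ lev u.1).card := by
            refine Finset.card_le_card fun v hv => ?_
            obtain ⟨w, hw, rfl⟩ := Finset.mem_map.1 hv
            exact Finset.mem_filter.2 ⟨w.2, hmax w hw⟩
          _ ≤ (X.filter fun v => lev v ≤ lev u.1).card := hcount _
          _ ≤ _ := Finset.card_le_card
            (Finset.subset_biUnion_of_mem (fun u : Y => X.filter fun v => lev v ≤ lev u.1) hu))
  have hs : ∀ z : Fin n → ℕ, ∑ i, ∑ t ∈ Finset.range (z i), g ((t : ℝ) + ε i) =
      ∑ u ∈ Finset.univ.sigma fun i => Finset.range (z i), g (lev u) := by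
    intro z
    rw [Finset.sum_sigma]
  rw [hs, hs, ← hX, ← hY]
  calc ∑ u ∈ Y, g (lev u) = ∑ u : Y, g (lev u.1) := (Finset.sum_coe_sort Y fun u => g (lev u)).symm
    _ ≤ ∑ u : Y, g (lev (e u)) :=
      Finset.sum_le_sum fun u _ => hg (Finset.mem_filter.1 (hmem u)).2
    _ = ∑ v ∈ Finset.univ.map ⟨e, he⟩, g (lev v) := by rw [Finset.sum_map]; rfl
    _ ≤ ∑ v ∈ X, g (lev v) := by
      refine Finset.sum_le_sum_of_subset_of_nonneg (fun v hv => ?_) fun _ _ _ => hg0 _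
      obtain ⟨u, -, rfl⟩ := Finset.mem_map.1 hv
      exact (Finset.mem_filter.1 (hmem u)).1

/-- The numerical content of truthfulness.  Here `r` and `q` are the rank functions under the true and
under an untrue report of agent `i`, `x` and `y` are the egalitarian vectors, and `s` is the true
value of the bundle that `i` obtains by the untrue report.  If `x i < s`, then the tight set of `i`
under the truth has members `j` with `y j < x j`.  Under the untrue report they got stuck before `i`
had `x i + 1` units, hence in tight sets without `i`, which are tight under the truth as well.
Uncrossing contradicts that `y`, with entry `s` at `i`, is attainable under the truth. -/
lemma IsEgalitarian.le_of_update {σ : Equiv.Perm (Fin n)} {q : Fin n → Finset α → ℕ} {i : Fin n}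
    {s : ℕ} (hr : ∀ j, IsRank (r j)) (hq : ∀ j, IsRank (q j)) (hrq : ∀ j, j ≠ i → r j = q j)
    (hx : IsEgalitarian σ r x) (hy : IsEgalitarian σ q y)
    (hs : s ≤ y i) (hys : IsBounded r (Function.update y i s)) : s ≤ x i := by
  by_contra! hlt
  obtain ⟨J, hiJ, hJ, hJlev⟩ := hx.2 i
  choose J' hJ'mem hJ' hJ'lev using hy.2
  set K := J.filter fun j => Function.update y i s j < x j with hK
  set T := K.biUnion J' with hT
  have hiK : i ∉ K := by simp [hK, hlt.le]
  have hiT : i ∉ T := by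
    intro h
    obtain ⟨j, hj, hij⟩ := Finset.mem_biUnion.1 h
    have hne : j ≠ i := fun e => hiK (e ▸ hj)
    obtain ⟨hj1, hj2⟩ := Finset.mem_filter.1 hj
    rw [Function.update_of_ne hne] at hj2
    have h1 := hJlev j hj1
    have h2 := hJ'lev j i hij
    rcases h1 with h1 | ⟨h1, h1'⟩ <;> rcases h2 with h2 | ⟨h2, h2'⟩
    · omega
    · omega
    · omega
    · exact absurd (h1'.trans h2') (lt_irrefl _)
  have hTq : IsTight q y T := IsTight.biUnion hq hy.1 fun j _ => hJ' j
  have hTr : IsTight r (Function.update y i s) T := by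
    obtain ⟨S, hS⟩ := hTq
    have hne : ∀ j ∈ T, j ≠ i := fun j hj e => hiT (e ▸ hj)
    refine ⟨S, ?_⟩
    have e1 : ∑ j ∈ T, r j S = ∑ j ∈ T, q j S :=
      Finset.sum_congr rfl fun j hj => by rw [hrq j (hne j hj)]
    have e2 : ∑ j ∈ T, Function.update y i s j = ∑ j ∈ T, y j :=
      Finset.sum_congr rfl fun j hj => Function.update_of_ne (hne j hj) _ _
    omega
  have h1 := IsTight.uncross hr hx.1 hys hJ hTr
  have h2 : ∑ j ∈ J ∪ T, Function.update y i s j =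
      ∑ j ∈ J \ T, Function.update y i s j + ∑ j ∈ T, Function.update y i s j := by
    rw [← Finset.sum_union Finset.sdiff_disjoint, Finset.sdiff_union_self_eq_union]
  have h3 : ∑ j ∈ J, x j = ∑ j ∈ J \ T, x j + ∑ j ∈ J ∩ T, x j := by
    rw [← Finset.sum_union (Finset.disjoint_sdiff_inter J T), Finset.sdiff_union_inter]
  have h4 : ∑ j ∈ J \ T, x j < ∑ j ∈ J \ T, Function.update y i s j := by
    refine Finset.sum_lt_sum (fun j hj => ?_) ⟨i, Finset.mem_sdiff.2 ⟨hiJ, hiT⟩, by simpa using hlt⟩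
    by_contra! hc
    obtain ⟨hj1, hj2⟩ := Finset.mem_sdiff.1 hj
    exact hj2 (Finset.mem_biUnion.2 ⟨j, Finset.mem_filter.2 ⟨hj1, hc⟩, hJ'mem j⟩)
  omega

end Tight

/-! ### Augmenting an allocation by an auction -/

/-- Reasoning about a loop that counts down, by an invariant. -/
lemma fin_foldr_induction {K : ℕ} {S : Type*} {f : Fin K → S → S} {init : S}
    (Inv : ℕ → S → Prop) (h0 : Inv K init)
    (hs : ∀ (k : Fin K) (s : S), Inv (k + 1) s → Inv k (f k s)) : Inv 0 (Fin.foldr K f init) := by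
  have key : ∀ k (hk : k ≤ K) s, Inv k s → Inv 0 (Fin.foldr.loop K f k hk s) := by
    intro k
    induction k with
    | zero => intro hk s h; simpa [Fin.foldr.loop] using h
    | succ k ih => intro hk s h; exact ih _ _ (hs ⟨k, hk⟩ s h)
  exact key K le_rfl init h0

section Auction

variable {n m : ℕ}

/-- The set of items whose owner is `j`. -/
def bundleOf (o : Fin m → Option (Fin n)) (j : Fin n) : Finset (Fin m) :=
  Finset.univ.filter fun b => o b = some j

lemma mem_bundleOf {o : Fin m → Option (Fin n)} {j : Fin n} {b : Fin m} :
    b ∈ bundleOf o j ↔ o b = some j := by simp [bundleOf]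

/-- The item `b` would raise the value of agent `j`. -/
def IsUseful (v : Fin n → Finset (Fin m) → ℕ) (o : Fin m → Option (Fin n)) (j : Fin n)
    (b : Fin m) : Prop :=
  v j (bundleOf o j) < v j (insert b (bundleOf o j))

instance (v : Fin n → Finset (Fin m) → ℕ) (o : Fin m → Option (Fin n)) (j : Fin n)
    (b : Fin m) : Decidable (IsUseful v o j b) := by
  unfold IsUseful; infer_instance

/-- A state of the auction: the owners of the items, their prices (at most `m + 1`), and the agent
who has to buy an item next, if any. -/
structure AuctionState (n m : ℕ) where
  owner : Fin m → Option (Fin n)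
  price : Fin m → Fin (m + 2)
  buyer : Option (Fin n)

/-- The first item with the property `P`, if there is one, and `init` otherwise. -/
def findItem (P : Fin m → Prop) [DecidablePred P] (init : Option (Fin m)) : Option (Fin m) :=
  Fin.foldr m (fun b acc => if P b then some b else acc) init

lemma findItem_spec (P : Fin m → Prop) [DecidablePred P] (init : Option (Fin m)) :
    (findItem P init = init ∧ ∀ b, ¬ P b) ∨ ∃ c, findItem P init = some c ∧ P c := by
  have := fin_foldr_induction (K := m) (f := fun b acc => if P b then some b else acc)
    (init := init) (fun k acc => (acc = init ∧ ∀ b : Fin m, k ≤ b → ¬ P b) ∨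
      ∃ c, acc = some c ∧ P c) (Or.inl ⟨rfl, fun b hb => absurd b.2 (by omega)⟩) (by
      intro k s h
      by_cases hk : P k
      · exact Or.inr ⟨k, if_pos hk, hk⟩
      · rw [if_neg hk]
        refine h.imp_left fun h => ⟨h.1, fun b hb => ?_⟩
        rcases hb.eq_or_lt with e | e
        · rwa [← Fin.ext e]
        · exact h.2 b e)
  simpa [findItem] using this

/-- A useful item for agent `j` of least price, if there is one of price at most `m`. -/
def cheapest (v : Fin n → Finset (Fin m) → ℕ) (s : AuctionState n m) (j : Fin n) :
    Option (Fin m) :=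
  Fin.foldr (m + 1) (fun q acc =>
    findItem (fun b => IsUseful v s.owner j b ∧ (s.price b : ℕ) = q) acc) none

lemma cheapest_spec (v : Fin n → Finset (Fin m) → ℕ) (s : AuctionState n m) (j : Fin n) :
    (cheapest v s j = none ∧ ∀ b, IsUseful v s.owner j b → m < s.price b) ∨
      ∃ c, cheapest v s j = some c ∧ IsUseful v s.owner j c ∧ (s.price c : ℕ) ≤ m ∧
        ∀ b, IsUseful v s.owner j b → s.price c ≤ s.price b := by
  have := fin_foldr_induction (K := m + 1) (f := fun q acc =>
      findItem (fun b => IsUseful v s.owner j b ∧ (s.price b : ℕ) = q) acc) (init := none)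
    (fun k acc => (acc = none ∧ ∀ b, IsUseful v s.owner j b → k ≤ s.price b → m < s.price b) ∨
      ∃ c, acc = some c ∧ IsUseful v s.owner j c ∧ (s.price c : ℕ) ≤ m ∧
        ∀ b, IsUseful v s.owner j b → k ≤ s.price b → s.price c ≤ s.price b)
    (Or.inl ⟨rfl, fun b _ hb => by omega⟩) (by
      intro k acc h
      rcases findItem_spec (fun b => IsUseful v s.owner j b ∧ (s.price b : ℕ) = k) acc with
        ⟨h1, h2⟩ | ⟨c, h1, h2, h3⟩
      · rw [h1]
        have hk : ∀ b, IsUseful v s.owner j b → (k : ℕ) ≤ s.price b → (k : ℕ) + 1 ≤ s.price b :=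
          fun b hb hkb => lt_of_le_of_ne hkb fun e => h2 b ⟨hb, e.symm⟩
        rcases h with h | ⟨c, h3, h4, h5, h6⟩
        · exact Or.inl ⟨h.1, fun b hb hkb => h.2 b hb (hk b hb hkb)⟩
        · exact Or.inr ⟨c, h3, h4, h5, fun b hb hkb => h6 b hb (hk b hb hkb)⟩
      · refine Or.inr ⟨c, h1, h2, by omega, fun b _ hkb => ?_⟩
        rw [Fin.le_def]
        omega)
  simpa [cheapest] using this

/-- A price raised by one, but not beyond the largest admissible price `m + 1`. -/
def raise (p : Fin (m + 2)) : Fin (m + 2) := ⟨min (p + 1) (m + 1), by omega⟩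

/-- Agent `j` takes item `b` and raises its price; the previous owner of `b` has to buy next. -/
def AuctionState.sell (s : AuctionState n m) (j : Fin n) (b : Fin m) : AuctionState n m where
  owner := Function.update s.owner b (some j)
  price := Function.update s.price b (raise (s.price b))
  buyer := s.owner b

/-- One step of the auction: the buyer takes a cheapest useful item. -/
def AuctionState.step (v : Fin n → Finset (Fin m) → ℕ) (s : AuctionState n m) : AuctionState n m :=
  s.buyer.elim s fun j => (cheapest v s j).elim s fun b => s.sell j b

/-- The auction that starts with the given owners, prices zero, and buyer `i`. -/
def auctionStart (o : Fin m → Option (Fin n)) (i : Fin n) : AuctionState n m :=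
  ⟨o, fun _ => 0, some i⟩

/-- The final state of an auction.  As every sale raises a price and the sum of the `m` prices is at
most `m * (m + 1)`, no sale is possible after `(m + 1) * (m + 1)` steps. -/
def auction (v : Fin n → Finset (Fin m) → ℕ) (o : Fin m → Option (Fin n)) (i : Fin n) :
    AuctionState n m :=
  Fin.foldr (m + 1) (fun _ s => Fin.foldr (m + 1) (fun _ s => s.step v) s) (auctionStart o i)

/-- Try to raise the utility of agent `i` by one; if this fails, then keep the allocation. -/
def augmentAgent (v : Fin n → Finset (Fin m) → ℕ) (i : Fin n) (o : Fin m → Option (Fin n)) :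
    Fin m → Option (Fin n) :=
  if (auction v o i).buyer = none then (auction v o i).owner else o

/-- The invariant of an auction for agent `i` that starts from bundles of sizes `x`.  For all agents
but the buyer, an item of their bundle is at most one unit more expensive than every item for which
it could be exchanged; for the buyer a similar condition accounts for the lost item. -/
structure AuctionInv (r : Fin n → Finset (Fin m) → ℕ) (x : Fin n → ℕ) (i : Fin n)
    (s : AuctionState n m) : Prop where
  indep : ∀ k, Indep (r k) (bundleOf s.owner k)
  price_zero : ∀ b, s.owner b = none → (s.price b : ℕ) = 0
  card_add : ∀ k, (bundleOf s.owner k).card + (if s.buyer = some k then 1 else 0) =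
    x k + (if k = i then 1 else 0)
  content : ∀ j, s.buyer = some j → ∀ k, k ≠ j → ∀ a ∈ bundleOf s.owner k,
    ∀ c ∉ bundleOf s.owner k, Indep (r k) (insert c ((bundleOf s.owner k).erase a)) →
      (s.price a : ℕ) ≤ s.price c + 1
  buyer_one : ∀ j, s.buyer = some j → ∀ a ∈ bundleOf s.owner j, ∀ c ∉ bundleOf s.owner j,
    Indep (r j) (insert c ((bundleOf s.owner j).erase a)) →
    ¬ Indep (r j) (insert c (bundleOf s.owner j)) → (s.price a : ℕ) ≤ s.price c + 1
  buyer_two : ∀ j, s.buyer = some j → ∀ a ∈ bundleOf s.owner j, ∀ b ∉ bundleOf s.owner j,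
    ∀ c ∉ bundleOf s.owner j, b ≠ c →
    Indep (r j) (insert b (insert c ((bundleOf s.owner j).erase a))) →
      (s.price a : ℕ) ≤ max (s.price b : ℕ) (s.price c) + 1

variable {r : Fin n → Finset (Fin m) → ℕ} {x : Fin n → ℕ} {i : Fin n}

lemma disjoint_bundleOf (o : Fin m → Option (Fin n)) {k l : Fin n} (hkl : k ≠ l) :
    Disjoint (bundleOf o k) (bundleOf o l) := by
  rw [Finset.disjoint_left]
  intro a ha hb
  rw [mem_bundleOf] at ha hb
  exact hkl (by simpa using ha.symm.trans hb)

lemma isBounded_card (hr : ∀ k, IsRank (r k)) {o : Fin m → Option (Fin n)}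
    (hind : ∀ k, Indep (r k) (bundleOf o k)) :
    IsBounded r (fun k => (bundleOf o k).card) := fun J S =>
  (Finset.sum_congr rfl fun k _ => (hind k).symm).trans_le
    (isBounded_of_bundles hr (fun _ _ => disjoint_bundleOf o) J S)

lemma auctionInv_start {o : Fin m → Option (Fin n)} (hind : ∀ k, Indep (r k) (bundleOf o k))
    (hx : ∀ k, (bundleOf o k).card = x k) (i : Fin n) : AuctionInv r x i (auctionStart o i) where
  indep := hind
  price_zero := fun _ _ => rfl
  card_add := by
    intro k
    simp only [auctionStart, hx, Option.some.injEq, eq_comm]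
  content := fun _ _ _ _ _ _ _ _ _ => Nat.zero_le _
  buyer_one := fun _ _ _ _ _ _ _ _ => Nat.zero_le _
  buyer_two := fun _ _ _ _ _ _ _ _ _ _ => Nat.zero_le _

lemma bundleOf_update_self (o : Fin m → Option (Fin n)) (b : Fin m) (j : Fin n) :
    bundleOf (Function.update o b (some j)) j = insert b (bundleOf o j) := by
  ext a
  by_cases h : a = b
  · subst h; simp [mem_bundleOf]
  · simp [mem_bundleOf, h]

lemma bundleOf_update_of_ne (o : Fin m → Option (Fin n)) (b : Fin m) {j k : Fin n} (h : k ≠ j) :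
    bundleOf (Function.update o b (some j)) k = (bundleOf o k).erase b := by
  ext a
  by_cases hab : a = b
  · subst hab; simp [mem_bundleOf, h.symm]
  · simp [mem_bundleOf, hab]

lemma AuctionInv.sell (hr : ∀ k, IsRank (r k)) {s : AuctionState n m} (hs : AuctionInv r x i s)
    {j : Fin n} {b : Fin m} (hj : s.buyer = some j) (hb : IsUseful r s.owner j b)
    (hbm : (s.price b : ℕ) ≤ m)
    (hmin : ∀ c, IsUseful r s.owner j c → s.price b ≤ s.price c) :
    AuctionInv r x i (s.sell j b) := by
  have hbj : b ∉ bundleOf s.owner j := IsRank.notMem_of_lt_insert hb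
  have hpb : ((s.sell j b).price b : ℕ) = s.price b + 1 := by
    simp [AuctionState.sell, raise]; omega
  have hpne : ∀ a, a ≠ b → (s.sell j b).price a = s.price a := by
    intro a ha; simp [AuctionState.sell, ha]
  have hple : ∀ a, (s.price a : ℕ) ≤ (s.sell j b).price a := by
    intro a
    by_cases ha : a = b
    · subst ha; omega
    · rw [hpne a ha]
  have hBj : bundleOf (s.sell j b).owner j = insert b (bundleOf s.owner j) :=
    bundleOf_update_self _ _ _
  have hBk : ∀ k, k ≠ j → bundleOf (s.sell j b).owner k = (bundleOf s.owner k).erase b :=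
    fun k hk => bundleOf_update_of_ne _ _ hk
  have huse : ∀ c, c ∉ bundleOf s.owner j → Indep (r j) (insert c (bundleOf s.owner j)) →
      (s.price b : ℕ) ≤ s.price c := fun c hc hi => hmin c ((hr j).lt_insert hc hi)
  -- the buyer is content with her new bundle
  have hnewj : ∀ a ∈ insert b (bundleOf s.owner j), ∀ c ∉ insert b (bundleOf s.owner j),
      Indep (r j) (insert c ((insert b (bundleOf s.owner j)).erase a)) →
      ((s.sell j b).price a : ℕ) ≤ (s.sell j b).price c + 1 := by
    intro a ha c hc hi
    simp only [Finset.mem_insert, not_or] at hc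
    rw [hpne c hc.1]
    by_cases hab : a = b
    · subst hab
      rw [Finset.erase_insert hbj] at hi
      have := huse c hc.2 hi
      omega
    · have ha' := Finset.mem_of_mem_insert_of_ne ha hab
      rw [hpne a hab]
      rw [Finset.erase_insert_of_ne (Ne.symm hab)] at hi
      by_cases hci : Indep (r j) (insert c (bundleOf s.owner j))
      · have h1 := hs.buyer_two j hj a ha' c hc.2 b hbj hc.1 hi
        have h2 := huse c hc.2 hci
        omega
      · refine hs.buyer_one j hj a ha' c hc.2 ((hr j).indep_subset hi ?_) hci
        exact Finset.insert_subset_insert c (Finset.subset_insert b _)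
  refine ⟨?_, ?_, ?_, ?_, ?_, ?_⟩
  · intro k
    by_cases hk : k = j
    · subst hk
      rw [hBj]
      exact (hr k).indep_insert (hs.indep k) hb
    · rw [hBk k hk]
      exact (hr k).indep_subset (hs.indep k) (Finset.erase_subset _ _)
  · intro a ha
    have hab : a ≠ b := by
      rintro rfl
      simp [AuctionState.sell] at ha
    rw [hpne a hab]
    refine hs.price_zero a ?_
    simpa [AuctionState.sell, hab] using ha
  · intro k
    rw [← hs.card_add k, hj]
    change _ + (if s.owner b = some k then 1 else 0) = _
    by_cases hk : k = j
    · subst hk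
      rw [hBj, Finset.card_insert_of_notMem hbj, if_pos rfl, if_neg]
      exact fun h => hbj (mem_bundleOf.2 h)
    · rw [hBk k hk, if_neg (show ¬ some j = some k by simpa using Ne.symm hk)]
      by_cases hbk : s.owner b = some k
      · rw [if_pos hbk, Finset.card_erase_add_one (mem_bundleOf.2 hbk), add_zero]
      · rw [if_neg hbk, Finset.erase_eq_of_notMem (fun h => hbk (mem_bundleOf.1 h))]
  · intro l (hl : s.owner b = some l) k hkl a ha c hc hi
    by_cases hk : k = j
    · subst hk
      rw [hBj] at ha hc hi
      exact hnewj a ha c hc hi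
    · have hbk : b ∉ bundleOf s.owner k := by
        rw [mem_bundleOf, hl]
        simpa using Ne.symm hkl
      rw [hBk k hk, Finset.erase_eq_of_notMem hbk] at ha hc hi
      have h1 := hs.content j hj k hk a ha c hc hi
      have h2 := hple c
      rw [hpne a (fun e => hbk (e ▸ ha))]
      omega
  · intro l (hl : s.owner b = some l) a ha c hc hi hni
    have hlj : l ≠ j := fun e => hbj (mem_bundleOf.2 (e ▸ hl))
    have hbl : b ∈ bundleOf s.owner l := mem_bundleOf.2 hl
    rw [hBk l hlj] at ha hc hi hni
    obtain ⟨hab, ha'⟩ := Finset.mem_erase.1 ha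
    have hcb : c ≠ b := by
      rintro rfl
      rw [Finset.insert_erase hbl] at hni
      exact hni (hs.indep l)
    have hc' : c ∉ bundleOf s.owner l := fun h => hc (Finset.mem_erase.2 ⟨hcb, h⟩)
    -- the smaller set `A - b - a + c` can be augmented from `A`, and only by `b`
    have hcard : (insert c (((bundleOf s.owner l).erase b).erase a)).card <
        (bundleOf s.owner l).card := by
      have e1 := Finset.card_insert_le c (((bundleOf s.owner l).erase b).erase a)
      have e2 := Finset.card_erase_add_one ha
      have e3 := Finset.card_erase_add_one hbl
      omega
    obtain ⟨e, he, hne, hei⟩ := (hr l).exists_indep_insert hi (hs.indep l) hcard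
    have heab : e = a ∨ e = b := by
      by_contra! h
      exact hne (by simp [he, h.1, h.2])
    rcases heab with rfl | rfl
    · rw [Finset.insert_comm, Finset.insert_erase ha] at hei
      exact absurd hei hni
    · rw [Finset.insert_comm, Finset.erase_right_comm,
        Finset.insert_erase (Finset.mem_erase.2 ⟨Ne.symm hab, hbl⟩)] at hei
      have h1 := hs.content j hj l hlj a ha' c hc' hei
      have h2 := hple c
      rw [hpne a hab]
      omega
  · intro l (hl : s.owner b = some l) a ha c hc d hd hcd hi
    have hlj : l ≠ j := fun e => hbj (mem_bundleOf.2 (e ▸ hl))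
    have hbl : b ∈ bundleOf s.owner l := mem_bundleOf.2 hl
    rw [hBk l hlj] at ha hc hd hi
    obtain ⟨hab, ha'⟩ := Finset.mem_erase.1 ha
    have hba : b ∈ (bundleOf s.owner l).erase a := Finset.mem_erase.2 ⟨Ne.symm hab, hbl⟩
    rw [Finset.erase_right_comm] at hi
    rw [hpne a hab]
    have fin : ∀ e, e ∉ (bundleOf s.owner l).erase b → e ≠ b →
        Indep (r l) (insert e ((bundleOf s.owner l).erase a)) →
        (s.price a : ℕ) ≤ (s.sell j b).price e + 1 := by
      intro e he heb hei
      have h1 := hs.content j hj l hlj a ha' e (fun h => he (Finset.mem_erase.2 ⟨heb, h⟩)) hei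
      have h2 := hple e
      omega
    by_cases hcb : c = b
    · subst hcb
      rw [Finset.insert_comm, Finset.insert_erase hba] at hi
      exact (fin d hd (Ne.symm hcd) hi).trans (by omega)
    by_cases hdb : d = b
    · subst hdb
      rw [Finset.insert_erase hba] at hi
      exact (fin c hc hcd hi).trans (by omega)
    have hia := (hr l).indep_subset (hs.indep l) (Finset.erase_subset a (bundleOf s.owner l))
    have hc' : c ∉ bundleOf s.owner l := fun h => hc (Finset.mem_erase.2 ⟨hcb, h⟩)
    have hd' : d ∉ bundleOf s.owner l := fun h => hd (Finset.mem_erase.2 ⟨hdb, h⟩)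
    have hcard : ((bundleOf s.owner l).erase a).card <
        (insert c (insert d (((bundleOf s.owner l).erase a).erase b))).card := by
      rw [Finset.card_insert_of_notMem (by simp [hcd, hc']),
        Finset.card_insert_of_notMem (by simp [hd'])]
      have e3 := Finset.card_erase_add_one hba
      omega
    obtain ⟨e, he, hne, hei⟩ := (hr l).exists_indep_insert hia hi hcard
    have hecd : e = c ∨ e = d := by
      simp only [Finset.mem_insert] at he
      rcases he with h | h | h
      · exact Or.inl h
      · exact Or.inr h
      · exact absurd (Finset.mem_of_mem_erase h) hne
    rcases hecd with rfl | rfl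
    · exact (fin e hc hcb hei).trans (by omega)
    · exact (fin e hd hdb hei).trans (by omega)

lemma AuctionInv.step (hr : ∀ k, IsRank (r k)) {s : AuctionState n m} (hs : AuctionInv r x i s) :
    AuctionInv r x i (s.step r) := by
  unfold AuctionState.step
  rcases hj : s.buyer with _ | j
  · exact hs
  · rcases cheapest_spec r s j with ⟨h, -⟩ | ⟨c, h, h1, h2, h3⟩
    · simpa [h] using hs
    · simpa [h] using hs.sell hr hj h1 h2 h3

lemma AuctionState.step_eq_or (v : Fin n → Finset (Fin m) → ℕ) (s : AuctionState n m) :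
    s.step v = s ∨ ∑ b, ((s.step v).price b : ℕ) = ∑ b, (s.price b : ℕ) + 1 := by
  unfold AuctionState.step
  rcases hj : s.buyer with _ | j
  · exact Or.inl rfl
  · rcases cheapest_spec v s j with ⟨h, -⟩ | ⟨c, h, -, h2, -⟩
    · exact Or.inl (by simp [h])
    · right
      simp only [h, Option.elim_some, AuctionState.sell]
      rw [← Finset.add_sum_erase _ _ (Finset.mem_univ c),
        ← Finset.add_sum_erase Finset.univ (fun b => (s.price b : ℕ)) (Finset.mem_univ c)]
      have : ∑ b ∈ Finset.univ.erase c,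
          ((Function.update s.price c (raise (s.price c)) b : Fin (m + 2)) : ℕ) =
          ∑ b ∈ Finset.univ.erase c, (s.price b : ℕ) :=
        Finset.sum_congr rfl fun b hb => by rw [Function.update_of_ne (Finset.ne_of_mem_erase hb)]
      rw [this]
      simp [raise]
      omega

lemma fin_foldr_const {S : Type*} (f : S → S) (K : ℕ) (s : S) :
    Fin.foldr K (fun _ s => f s) s = f^[K] s := by
  induction K with
  | zero => simp
  | succ K ih => rw [Fin.foldr_succ, ih, Function.iterate_succ_apply']

lemma auction_eq_iterate (v : Fin n → Finset (Fin m) → ℕ) (o : Fin m → Option (Fin n)) (i : Fin n) :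
    auction v o i = (AuctionState.step v)^[(m + 1) * (m + 1)] (auctionStart o i) := by
  unfold auction
  simp only [fin_foldr_const]
  rw [Function.iterate_mul]

/-- The auction runs to its end: every further step would raise the sum of all prices. -/
lemma step_auction (v : Fin n → Finset (Fin m) → ℕ) (o : Fin m → Option (Fin n)) (i : Fin n) :
    (auction v o i).step v = auction v o i := by
  by_contra hne
  have key : ∀ k ≤ (m + 1) * (m + 1),
      k ≤ ∑ b, (((AuctionState.step v)^[k] (auctionStart o i)).price b : ℕ) := by
    intro k
    induction k with
    | zero => simp
    | succ k ih =>
      intro hk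
      have h1 := ih (by omega)
      rw [Function.iterate_succ_apply']
      rcases AuctionState.step_eq_or v ((AuctionState.step v)^[k] (auctionStart o i)) with h | h
      · exfalso
        apply hne
        obtain ⟨d, hd⟩ := Nat.exists_eq_add_of_le (show k ≤ (m + 1) * (m + 1) by omega)
        have h2 : auction v o i = (AuctionState.step v)^[k] (auctionStart o i) := by
          rw [auction_eq_iterate, hd, add_comm, Function.iterate_add_apply]
          exact Function.iterate_fixed h d
        rw [h2, h]
      · omega
  have h1 := key _ le_rfl
  have h2 : ∀ s : AuctionState n m, ∑ b, (s.price b : ℕ) ≤ m * (m + 1) := by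
    intro s
    calc ∑ b, (s.price b : ℕ) ≤ ∑ _b : Fin m, (m + 1) :=
          Finset.sum_le_sum fun b _ => by omega
      _ = m * (m + 1) := by simp
  have h3 := h1.trans (h2 _)
  nlinarith

lemma auctionInv_auction (hr : ∀ k, IsRank (r k)) {o : Fin m → Option (Fin n)}
    (hind : ∀ k, Indep (r k) (bundleOf o k)) (hx : ∀ k, (bundleOf o k).card = x k) (i : Fin n) :
    AuctionInv r x i (auction r o i) := by
  rw [auction_eq_iterate]
  generalize (m + 1) * (m + 1) = k
  induction k with
  | zero => exact auctionInv_start hind hx i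
  | succ k ih => rw [Function.iterate_succ_apply']; exact ih.step hr

/-- An auction that ends with an unsatisfied buyer: there is a gap in the prices, and the agents
whose bundles exhaust the cheap items form a tight set, which contains all owners of expensive
items, the buyer, and hence also the agent `i` for whom the auction was held. -/
lemma AuctionInv.exists_isTight (hr : ∀ k, IsRank (r k)) {s : AuctionState n m}
    (hs : AuctionInv r x i s) (hx : IsBounded r x) {j : Fin n} (hj : s.buyer = some j)
    (hstuck : ∀ b, IsUseful r s.owner j b → m < s.price b) :
    ∃ J : Finset (Fin n), i ∈ J ∧ IsTight r x J := by
  obtain ⟨g, hg1, hgm, hg⟩ : ∃ g, 1 ≤ g ∧ g ≤ m + 1 ∧ ∀ b, (s.price b : ℕ) ≠ g := by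
    -- `m` items have at most `m` different prices
    have hlt : (Finset.univ.image fun b => (s.price b : ℕ)).card < (Finset.Icc 1 (m + 1)).card := by
      refine Finset.card_image_le.trans_lt ?_
      simp
    obtain ⟨g, hg, hg'⟩ := Finset.exists_mem_notMem_of_card_lt_card hlt
    rw [Finset.mem_Icc] at hg
    exact ⟨g, hg.1, hg.2, fun b hb => hg' (Finset.mem_image.2 ⟨b, Finset.mem_univ b, hb⟩)⟩
  set S : Finset (Fin m) := Finset.univ.filter fun b => (s.price b : ℕ) < g with hS
  have hmS : ∀ b, b ∈ S ↔ (s.price b : ℕ) < g := by simp [hS]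
  -- the agents whose bundles exhaust the cheap items
  set J : Finset (Fin n) := Finset.univ.filter fun k => r k S ≤ (bundleOf s.owner k ∩ S).card with hJ
  have hmJ : ∀ k, (∀ c ∈ S, c ∉ bundleOf s.owner k →
      ¬ Indep (r k) (insert c (bundleOf s.owner k ∩ S))) → k ∈ J := by
    intro k hk
    by_contra hkJ
    simp only [hJ, Finset.mem_filter, Finset.mem_univ, true_and, not_le] at hkJ
    have hi : Indep (r k) (bundleOf s.owner k ∩ S) :=
      (hr k).indep_subset (hs.indep k) Finset.inter_subset_left
    rw [← hi] at hkJ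
    obtain ⟨c, hcS, hc⟩ := (hr k).exists_lt_insert hkJ
    refine hk c hcS (fun hck => ?_) ((hr k).indep_insert hi hc)
    exact IsRank.notMem_of_lt_insert hc (Finset.mem_inter.2 ⟨hck, hcS⟩)
  have hjJ : j ∈ J := by
    refine hmJ j fun c hcS hcj hi => ?_
    have hci : ¬ Indep (r j) (insert c (bundleOf s.owner j)) := fun h => by
      have h1 := hstuck c ((hr j).lt_insert hcj h)
      have h2 := (hmS c).1 hcS
      omega
    obtain ⟨a, ha, haS, hai⟩ := (hr j).exists_exchange (hs.indep j) hi hci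
    have h1 := hs.buyer_one j hj a ha c hcj hai hci
    have h2 := (hmS c).1 hcS
    have h3 := hg a
    rw [hmS] at haS
    omega
  have hown : ∀ b, b ∉ S → ∃ k ∈ J, b ∈ bundleOf s.owner k := by
    intro b hbS
    have hpb := hbS
    rw [hmS] at hpb
    rcases hk : s.owner b with _ | k
    · have := hs.price_zero b hk
      omega
    · refine ⟨k, ?_, mem_bundleOf.2 hk⟩
      by_cases hkj : k = j
      · exact hkj ▸ hjJ
      refine hmJ k fun c hcS hck hi => ?_
      have h2 := (hmS c).1 hcS
      obtain ⟨a, ha, haS, hai⟩ : ∃ a ∈ bundleOf s.owner k, a ∉ S ∧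
          Indep (r k) (insert c ((bundleOf s.owner k).erase a)) := by
        by_cases hci : Indep (r k) (insert c (bundleOf s.owner k))
        · exact ⟨b, mem_bundleOf.2 hk, hbS, (hr k).indep_subset hci
            (Finset.insert_subset_insert c (Finset.erase_subset _ _))⟩
        · exact (hr k).exists_exchange (hs.indep k) hi hci
      have h1 := hs.content j hj k hkj a ha c hck hai
      have h3 := hg a
      rw [hmS] at haS
      omega
  have hcert : ∑ k ∈ J, r k S + Sᶜ.card ≤ ∑ k ∈ J, (bundleOf s.owner k).card := by
    have h1 : Sᶜ.card ≤ ∑ k ∈ J, (bundleOf s.owner k \ S).card := by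
      refine le_trans (Finset.card_le_card fun b hb => ?_) Finset.card_biUnion_le
      rw [Finset.mem_compl] at hb
      obtain ⟨k, hk, hbk⟩ := hown b hb
      exact Finset.mem_biUnion.2 ⟨k, hk, Finset.mem_sdiff.2 ⟨hbk, hb⟩⟩
    have h2 : ∑ k ∈ J, r k S ≤ ∑ k ∈ J, (bundleOf s.owner k ∩ S).card :=
      Finset.sum_le_sum fun k hk => (Finset.mem_filter.1 hk).2
    have h3 : ∑ k ∈ J, (bundleOf s.owner k).card =
        ∑ k ∈ J, (bundleOf s.owner k ∩ S).card + ∑ k ∈ J, (bundleOf s.owner k \ S).card := by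
      rw [← Finset.sum_add_distrib]
      exact Finset.sum_congr rfl fun k _ => (Finset.card_inter_add_card_sdiff _ _).symm
    omega
  have hsum : ∑ k ∈ J, (bundleOf s.owner k).card + 1 =
      ∑ k ∈ J, x k + (if i ∈ J then 1 else 0) := by
    have := Finset.sum_congr (rfl : J = J) fun k _ => hs.card_add k
    rw [Finset.sum_add_distrib, Finset.sum_add_distrib, hj] at this
    simpa [hjJ, eq_comm] using this
  have hb := hx J S
  -- `j ∈ J` lacks an item; if `i`, who has one more than `x i`, were not in `J`, then the sum of `x`
  -- over `J` would exceed the bound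
  by_cases hi : i ∈ J
  · rw [if_pos hi] at hsum
    exact ⟨J, hi, S, by omega⟩
  · rw [if_neg hi] at hsum
    omega

/-- The result of trying to augment the bundle of agent `i`. -/
lemma augmentAgent_spec (hr : ∀ k, IsRank (r k)) {o : Fin m → Option (Fin n)}
    (hind : ∀ k, Indep (r k) (bundleOf o k)) (i : Fin n) :
    ((∀ k, Indep (r k) (bundleOf (augmentAgent r i o) k)) ∧
      ∀ k, (bundleOf (augmentAgent r i o) k).card =
        (bundleOf o k).card + (if k = i then 1 else 0)) ∨
    (augmentAgent r i o = o ∧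
      ∃ J : Finset (Fin n), i ∈ J ∧ IsTight r (fun k => (bundleOf o k).card) J) := by
  have hinv := auctionInv_auction hr hind (fun _ => rfl) i
  have hx := isBounded_card hr hind
  unfold augmentAgent
  rcases hj : (auction r o i).buyer with _ | j
  · left
    rw [if_pos rfl]
    refine ⟨hinv.indep, fun k => ?_⟩
    have := hinv.card_add k
    rw [hj] at this
    simpa using this
  · right
    refine ⟨if_neg (by simp), hinv.exists_isTight hr hx hj ?_⟩
    have hst := step_auction r o i
    rcases cheapest_spec r (auction r o i) j with ⟨-, h⟩ | ⟨c, h, -, h2, -⟩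
    · exact h
    · exfalso
      unfold AuctionState.step at hst
      rw [hj] at hst
      simp only [h, Option.elim_some] at hst
      have h4 := congrArg (fun s => (s.price c : ℕ)) hst
      simp [AuctionState.sell, raise] at h4
      omega

end Auction

/-! ### The egalitarian allocation -/

section Egalitarian

variable {n m : ℕ}

/-- One round: every agent, in the order of priority, is given the opportunity to raise her utility
by one.  As `Fin.foldr` counts down, the index `k` stands for the agent at position `n - (k + 1)`. -/
def egalitarianRound (σ : Equiv.Perm (Fin n)) (v : Fin n → Finset (Fin m) → ℕ)
    (o : Fin m → Option (Fin n)) : Fin m → Option (Fin n) :=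
  Fin.foldr n (fun k o => Fin.foldr n
    (fun i o => if (σ i : ℕ) = n - (k + 1) then augmentAgent v i o else o) o) o

/-- The owners of the items in the egalitarian allocation, the result of `m + 1` rounds. -/
def egalitarianOwner (σ : Equiv.Perm (Fin n)) (v : Fin n → Finset (Fin m) → ℕ) :
    Fin m → Option (Fin n) :=
  Fin.foldr (m + 1) (fun _ o => egalitarianRound σ v o) fun _ => none

lemma fin_foldr_ite_eq {K : ℕ} {S : Type*} (P : Fin K → Prop) [DecidablePred P] (a : Fin K)
    (hP : ∀ i, P i ↔ i = a) (f : Fin K → S → S) (s : S) :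
    Fin.foldr K (fun i s => if P i then f i s else s) s = f a s := by
  have := fin_foldr_induction (f := fun i s => if P i then f i s else s) (init := s)
    (fun k t => if k ≤ a then t = f a s else t = s) (by rw [if_neg (by omega)]) (by
      intro k t h
      by_cases hk : k = a
      · subst hk
        simp only [hP, if_true]
        rw [if_neg (by omega)] at h
        rw [if_pos le_rfl, h]
      · simp only [hP, if_neg hk]
        have : (k : ℕ) ≠ a := fun e => hk (Fin.ext e)
        by_cases hka : (k : ℕ) ≤ a
        · rw [if_pos (by omega)] at h
          rwa [if_pos hka]
        · rw [if_neg (by omega)] at h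
          rwa [if_neg hka])
  simpa using this

/-- The invariant of the rounds, after `t` full rounds and after the `d` agents of highest priority
had their turn in the current round: every agent received a unit at each of her turns, or she got
stuck and lies in a tight set, as in the definition of egalitarian vectors. -/
def RoundInv (σ : Equiv.Perm (Fin n)) (r : Fin n → Finset (Fin m) → ℕ) (t d : ℕ)
    (o : Fin m → Option (Fin n)) : Prop :=
  (∀ k, Indep (r k) (bundleOf o k)) ∧
    ∀ i, (bundleOf o i).card ≤ t + (if (σ i : ℕ) < d then 1 else 0) ∧
      ((bundleOf o i).card = t + (if (σ i : ℕ) < d then 1 else 0) ∨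
        ∃ J : Finset (Fin n), i ∈ J ∧ IsTight r (fun k => (bundleOf o k).card) J ∧
          ∀ j ∈ J, (bundleOf o j).card ≤ (bundleOf o i).card ∨
            ((bundleOf o j).card = (bundleOf o i).card + 1 ∧ σ j < σ i))

variable {r : Fin n → Finset (Fin m) → ℕ} {σ : Equiv.Perm (Fin n)}

lemma RoundInv.augmentAgent (hr : ∀ k, IsRank (r k)) {t d : ℕ} {o : Fin m → Option (Fin n)}
    (h : RoundInv σ r t d o) {i : Fin n} (hi : (σ i : ℕ) = d) :
    RoundInv σ r t (d + 1) (augmentAgent r i o) := by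
  have hσ : ∀ k, k ≠ i → ((σ k : ℕ) < d + 1 ↔ (σ k : ℕ) < d) := by
    intro k hk
    have : (σ k : ℕ) ≠ σ i := fun e => hk (σ.injective (Fin.ext e))
    omega
  obtain ⟨hind, hlev⟩ := h
  rcases augmentAgent_spec hr hind i with ⟨h1, h2⟩ | ⟨h1, J, hiJ, hJ⟩
  · have hb := isBounded_card hr h1
    -- a tight set cannot contain `i`, whose bundle grew
    have hnot : ∀ J : Finset (Fin n), IsTight r (fun k => (bundleOf o k).card) J → i ∉ J := by
      intro J hJ hiJ
      have h3 := hJ.sum_le hb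
      simp only [h2, Finset.sum_add_distrib, Finset.sum_ite_eq', hiJ, if_true] at h3
      omega
    refine ⟨h1, fun k => ?_⟩
    by_cases hk : k = i
    · subst hk
      rw [h2, if_pos rfl, if_pos (by omega)]
      obtain ⟨h3, h4⟩ := hlev k
      rw [if_neg (by omega)] at h3 h4
      rcases h4 with h4 | ⟨J, hkJ, hJ, -⟩
      · exact ⟨by omega, Or.inl (by omega)⟩
      · exact absurd hkJ (hnot J hJ)
    · have hc : ∀ l, l ≠ i → (bundleOf (PrioritizedEgalitarian.augmentAgent r i o) l).card =
          (bundleOf o l).card := fun l hl => by rw [h2, if_neg hl, add_zero]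
      rw [hc k hk]
      simp only [hσ k hk]
      refine ⟨(hlev k).1, (hlev k).2.imp_right fun ⟨J, hkJ, hJ, hJlev⟩ => ?_⟩
      have hne : ∀ j ∈ J, j ≠ i := fun j hj e => hnot J hJ (e ▸ hj)
      exact ⟨J, hkJ, hJ.congr fun j hj => (hc j (hne j hj)).symm,
        fun j hj => by rw [hc j (hne j hj)]; exact hJlev j hj⟩
  · rw [h1]
    refine ⟨hind, fun k => ?_⟩
    by_cases hk : k = i
    · subst hk
      obtain ⟨h3, h4⟩ := hlev k
      rw [if_neg (by omega)] at h3 h4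
      refine ⟨h3.trans (by omega), Or.inr ?_⟩
      rcases h4 with h4 | h4
      · refine ⟨J, hiJ, hJ, fun j _ => ?_⟩
        have h5 := (hlev j).1
        by_cases hj : (σ j : ℕ) < d
        · rw [if_pos hj] at h5
          have : σ j < σ k := by rw [Fin.lt_def]; omega
          rcases h5.eq_or_lt with h6 | h6
          · exact Or.inr ⟨by omega, this⟩
          · exact Or.inl (by omega)
        · rw [if_neg hj] at h5
          exact Or.inl (by omega)
      · exact h4
    · simp only [hσ k hk]
      exact hlev k

lemma RoundInv.egalitarianRound (hr : ∀ k, IsRank (r k)) {t : ℕ} {o : Fin m → Option (Fin n)}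
    (h : RoundInv σ r t 0 o) : RoundInv σ r (t + 1) 0 (egalitarianRound σ r o) := by
  have := fin_foldr_induction (K := n) (init := o) (f := fun k o => Fin.foldr n
    (fun i o => if (σ i : ℕ) = n - (k + 1) then PrioritizedEgalitarian.augmentAgent r i o else o) o)
    (fun k o => RoundInv σ r t (n - k) o) (by simpa using h) (by
      intro k o h
      have hd : n - (k : ℕ) = n - (k + 1) + 1 := by omega
      rw [fin_foldr_ite_eq (a := σ.symm k.rev) (hP := ?_)
        (f := fun i o => PrioritizedEgalitarian.augmentAgent r i o), hd]
      · exact h.augmentAgent hr (by simp [Fin.val_rev])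
      · intro i
        rw [← Fin.val_rev, Equiv.eq_symm_apply, Fin.ext_iff])
  change RoundInv σ r t (n - 0) (PrioritizedEgalitarian.egalitarianRound σ r o) at this
  obtain ⟨h1, h2⟩ := this
  refine ⟨h1, fun i => ?_⟩
  have h3 := h2 i
  simpa using h3

lemma roundInv_egalitarianOwner (hr : ∀ k, IsRank (r k)) :
    RoundInv σ r (m + 1) 0 (egalitarianOwner σ r) := by
  have hb : ∀ k : Fin n, bundleOf (fun _ : Fin m => (none : Option (Fin n))) k = ∅ := by
    intro k; ext a; simp [mem_bundleOf]
  have := fin_foldr_induction (K := m + 1) (f := fun _ o => egalitarianRound σ r o)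
    (init := fun _ => none) (fun k o => RoundInv σ r (m + 1 - k) 0 o)
    ⟨fun k => by rw [hb]; simp [Indep, (hr k).empty], fun i => by simp [hb]⟩ (by
      intro k o h
      have hd : m + 1 - (k : ℕ) = m + 1 - (k + 1) + 1 := by omega
      rw [hd]
      exact h.egalitarianRound hr)
  simpa [egalitarianOwner] using this

lemma indep_egalitarianOwner (hr : ∀ k, IsRank (r k)) (k : Fin n) :
    Indep (r k) (bundleOf (egalitarianOwner σ r) k) :=
  (roundInv_egalitarianOwner hr).1 k

/-- The sizes of the bundles form the egalitarian vector: in `m + 1` rounds every agent gets stuck,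
because there are only `m` items. -/
lemma isEgalitarian_egalitarianOwner (hr : ∀ k, IsRank (r k)) :
    IsEgalitarian σ r fun k => (bundleOf (egalitarianOwner σ r) k).card := by
  obtain ⟨h1, h2⟩ := roundInv_egalitarianOwner (σ := σ) hr
  refine ⟨isBounded_card hr h1, fun i => (h2 i).2.resolve_left fun h => ?_⟩
  have := (Finset.card_le_univ (bundleOf (egalitarianOwner σ r) i))
  simp at this h
  omega

end Egalitarian

/-! ### Submodular dichotomous valuations as rank functions -/

section RankOf

variable {α : Type*} [DecidableEq α] {f : Valuation α}

/-- The natural number valued version of a valuation. -/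
def rankOf {α : Type*} (f : Valuation α) (S : Finset α) : ℕ := ⌊f S⌋₊

lemma IsSubmodularDichotomous.coe_rankOf (hf : IsSubmodularDichotomous f) (S : Finset α) :
    (rankOf f S : ℝ) = f S := by
  have : ∃ k : ℕ, f S = k := by
    induction S using Finset.induction_on with
    | empty => exact ⟨0, by simpa using hf.normalized⟩
    | insert a S _ ih =>
      obtain ⟨k, hk⟩ := ih
      rcases hf.dichotomous S a with h | h
      · exact ⟨k, by linarith⟩
      · exact ⟨k + 1, by push_cast; linarith⟩
  obtain ⟨k, hk⟩ := this
  rw [rankOf, hk, Nat.floor_natCast]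

lemma IsSubmodularDichotomous.isRank (hf : IsSubmodularDichotomous f) : IsRank (rankOf f) where
  empty := by
    have := hf.coe_rankOf ∅
    rw [hf.normalized] at this
    exact_mod_cast this
  mono S T h := by
    have := hf.monotone S T h
    rw [← hf.coe_rankOf, ← hf.coe_rankOf] at this
    exact_mod_cast this
  insert_le S a := by
    have := hf.dichotomous S a
    rw [← hf.coe_rankOf, ← hf.coe_rankOf] at this
    have h : (rankOf f (insert a S) : ℝ) ≤ rankOf f S + 1 := by rcases this with h | h <;> linarith
    exact_mod_cast h
  submod S T a h := by
    have := hf.submodular S T a h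
    rw [← hf.coe_rankOf, ← hf.coe_rankOf, ← hf.coe_rankOf, ← hf.coe_rankOf] at this
    have h : (rankOf f (insert a T) : ℝ) + rankOf f S ≤ rankOf f (insert a S) + rankOf f T := by
      linarith
    exact_mod_cast h

lemma isSubmodularDichotomous_legalize (f : Valuation α) :
    IsSubmodularDichotomous (legalize f) := by
  unfold legalize
  split_ifs with h
  · exact h
  · exact ⟨rfl, fun _ _ _ => le_rfl, fun _ _ => Or.inl (sub_self _), fun _ _ _ _ => le_rfl⟩

lemma legalize_eq_self (hf : IsSubmodularDichotomous f) : legalize f = f := if_pos hf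

end RankOf

/-! ### Lorenz domination -/

section Lorenz

variable {n : ℕ}

/-- The sum of the `k` least entries of a vector `v` is the maximum over all `θ` of
`k * θ - ∑ i, (θ - v i)⁺`; so Lorenz domination can be checked by means of these truncated sums. -/
lemma lorenzGE_of_truncated {v w : Fin n → ℝ}
    (h : ∀ θ : ℝ, ∑ i, max (θ - w i) 0 ≤ ∑ i, max (θ - v i) 0) :
    LorenzGE (w ∘ Tuple.sort w) (v ∘ Tuple.sort v) := by
  intro k
  set s := v ∘ Tuple.sort v with hs
  set t := w ∘ Tuple.sort w with ht
  have hmono : Monotone s := Tuple.monotone_sort v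
  have h1 := h (s k)
  rw [← Equiv.sum_comp (Tuple.sort w), ← Equiv.sum_comp (Tuple.sort v) (fun i => max (s k - v i) 0)]
    at h1
  have h2 : ∑ j, max (s k - s j) 0 = ∑ j ∈ Finset.Iic k, (s k - s j) := by
    rw [← Finset.sum_subset (Finset.subset_univ (Finset.Iic k))]
    · refine Finset.sum_congr rfl fun j hj => max_eq_left ?_
      linarith [hmono (Finset.mem_Iic.1 hj)]
    · intro j _ hj
      rw [Finset.mem_Iic, not_le] at hj
      exact max_eq_right (by linarith [hmono hj.le])
  have h3 : ∑ j ∈ Finset.Iic k, (s k - t j) ≤ ∑ j, max (s k - t j) 0 :=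
    calc _ ≤ ∑ j ∈ Finset.Iic k, max (s k - t j) 0 := Finset.sum_le_sum fun j _ => le_max_left _ _
      _ ≤ _ := Finset.sum_le_sum_of_subset_of_nonneg (Finset.subset_univ _)
        fun _ _ _ => le_max_right _ _
  have h4 : ∑ j ∈ Finset.Iic k, (s k - t j) ≤ ∑ j ∈ Finset.Iic k, (s k - s j) :=
    h3.trans (h1.trans_eq h2)
  rw [Finset.sum_sub_distrib, Finset.sum_sub_distrib] at h4
  linarith

lemma sum_Iic_eq (s : Fin n → ℝ) (k : Fin n) :
    ∑ j ∈ Finset.Iic k, s j = ∑ j ∈ Finset.Iio k, s j + s k := by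
  rw [← Finset.Iio_insert, Finset.sum_insert (by simp), add_comm]

/-- Of two different vectors, the one with the larger prefix sums is larger where they first
differ. -/
lemma LorenzGE.lexMinGT_or_eq {s t : Fin n → ℝ} (h : LorenzGE s t) : LexMinGT s t ∨ s = t := by
  by_cases hst : s = t
  · exact Or.inr hst
  left
  obtain ⟨k0, hk0⟩ := Function.ne_iff.1 hst
  obtain ⟨k, hk, hmin⟩ := WellFounded.has_min (wellFounded_lt (α := Fin n)) {k | s k ≠ t k} ⟨k0, hk0⟩
  have heq : ∀ j < k, s j = t j := fun j hj => by
    by_contra hc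
    exact hmin j hc hj
  have h1 := h k
  rw [sum_Iic_eq, sum_Iic_eq, Finset.sum_congr rfl fun j hj => heq j (Finset.mem_Iio.1 hj)] at h1
  exact ⟨k, lt_of_le_of_ne (by linarith) (Ne.symm hk), heq⟩

lemma LorenzGE.antisymm {s t : Fin n → ℝ} (h : LorenzGE s t) (h' : LorenzGE t s) : s = t := by
  rcases h.lexMinGT_or_eq with ⟨k, hk, heq⟩ | h1
  · have h1 := h' k
    rw [sum_Iic_eq, sum_Iic_eq, Finset.sum_congr rfl fun j hj => heq j (Finset.mem_Iio.1 hj)] at h1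
    linarith
  · exact h1

variable {α : Type*} [DecidableEq α] [Fintype α] {r : Fin n → Finset α → ℕ} {x y : Fin n → ℕ}
  {σ : Equiv.Perm (Fin n)}

/-- The egalitarian vector, shifted by `ε`, is Lorenz dominating. -/
lemma lorenzGE_of_levels (hr : ∀ i, IsRank (r i)) (hx : IsBounded r x) (ε : Fin n → ℝ)
    (hP : ∀ i, ∃ J : Finset (Fin n), i ∈ J ∧ IsTight r x J ∧
      ∀ j ∈ J, (x j : ℝ) + ε j ≤ x i + ε i + 1) (hy : IsBounded r y)
    {v w : Fin n → ℝ} (hw : ∀ i, w i = x i + ε i) (hv : ∀ i, v i ≤ y i + ε i) :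
    LorenzGE (w ∘ Tuple.sort w) (v ∘ Tuple.sort v) := by
  refine lorenzGE_of_truncated fun θ => ?_
  set g : ℝ → ℝ := fun u => max (θ - u) 0 - max (θ - (u + 1)) 0 with hg
  have hanti : Antitone g := by
    intro a b hab
    simp only [hg]
    rcases max_cases (θ - a) 0 with h1 | h1 <;> rcases max_cases (θ - b) 0 with h2 | h2 <;>
      rcases max_cases (θ - (a + 1)) 0 with h3 | h3 <;>
      rcases max_cases (θ - (b + 1)) 0 with h4 | h4 <;> linarith
  have hnn : ∀ u, 0 ≤ g u := by
    intro u
    simp only [hg]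
    have := max_le_max (show θ - (u + 1) ≤ θ - u by linarith) (le_refl (0 : ℝ))
    linarith
  have hsum : ∀ z : Fin n → ℕ, ∑ i, ∑ t ∈ Finset.range (z i), g ((t : ℝ) + ε i) =
      ∑ i, max (θ - ε i) 0 - ∑ i, max (θ - (z i + ε i)) 0 := by
    intro z
    rw [← Finset.sum_sub_distrib]
    refine Finset.sum_congr rfl fun i _ => ?_
    have := Finset.sum_range_sub' (fun t : ℕ => max (θ - ((t : ℝ) + ε i)) 0) (z i)
    simp only [Nat.cast_zero, zero_add] at this
    rw [← this]
    refine Finset.sum_congr rfl fun t _ => ?_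
    simp only [hg]
    push_cast
    ring_nf
  have h1 := sum_weights_le hr hx ε hP hy g hanti hnn
  rw [hsum, hsum] at h1
  have h2 : ∑ i, max (θ - (y i + ε i)) 0 ≤ ∑ i, max (θ - v i) 0 :=
    Finset.sum_le_sum fun i _ => max_le_max (by linarith [hv i]) le_rfl
  simp only [hw]
  linarith

lemma IsEgalitarian.levels_zero (hx : IsEgalitarian σ r x) (i : Fin n) :
    ∃ J : Finset (Fin n), i ∈ J ∧ IsTight r x J ∧
      ∀ j ∈ J, (x j : ℝ) + (fun _ => 0 : Fin n → ℝ) j ≤ x i + (fun _ => 0 : Fin n → ℝ) i + 1 := by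
  obtain ⟨J, h1, h2, h3⟩ := hx.2 i
  refine ⟨J, h1, h2, fun j hj => ?_⟩
  have : x j ≤ x i + 1 := by rcases h3 j hj with h | h <;> omega
  have : (x j : ℝ) ≤ x i + 1 := by exact_mod_cast this
  simpa using this

lemma IsEgalitarian.sum_weights_le (hr : ∀ i, IsRank (r i)) (hx : IsEgalitarian σ r x)
    (hy : IsBounded r y) (g : ℝ → ℝ) (hg : Antitone g) (hg0 : ∀ u, 0 ≤ g u) :
    ∑ i, ∑ t ∈ Finset.range (y i), g t ≤ ∑ i, ∑ t ∈ Finset.range (x i), g t := by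
  simpa using PrioritizedEgalitarian.sum_weights_le hr hx.1 (fun _ => 0) hx.levels_zero hy g hg hg0

lemma IsEgalitarian.sum_le (hr : ∀ i, IsRank (r i)) (hx : IsEgalitarian σ r x)
    (hy : IsBounded r y) : ∑ i, y i ≤ ∑ i, x i := by
  have := hx.sum_weights_le hr hy (fun _ => 1) (fun _ _ _ => le_rfl) fun _ => zero_le_one
  simp only [Finset.sum_const, Finset.card_range, nsmul_eq_mul, mul_one] at this
  exact_mod_cast this

lemma IsEgalitarian.sum_sq_le (hr : ∀ i, IsRank (r i)) (hx : IsEgalitarian σ r x)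
    (hy : IsBounded r y) (hxy : ∑ i, x i = ∑ i, y i) :
    ∑ i, (x i : ℝ) ^ 2 ≤ ∑ i, (y i : ℝ) ^ 2 := by
  -- on the range of the relevant levels, `g u` is an affine function minus the increment of the
  -- square from `u` to `u + 1`
  set C : ℝ := 2 * (∑ i, x i : ℕ) with hC
  set g : ℝ → ℝ := fun u => max (C - (2 * u + 1)) 0 with hg
  have h1 := hx.sum_weights_le hr hy g (fun a b h => max_le_max (by linarith) le_rfl)
    fun u => le_max_right _ _
  have hsum : ∀ z : Fin n → ℕ, ∑ i, z i = ∑ i, x i →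
      ∑ i, ∑ t ∈ Finset.range (z i), g t = C * (∑ i, x i : ℕ) - ∑ i, (z i : ℝ) ^ 2 := by
    intro z hz
    have : ∀ i, ∑ t ∈ Finset.range (z i), g t = C * z i - (z i : ℝ) ^ 2 := by
      intro i
      have hi : z i ≤ ∑ i, x i := hz ▸ Finset.single_le_sum (fun _ _ => Nat.zero_le _)
        (Finset.mem_univ i)
      have e1 : ∀ t ∈ Finset.range (z i), g t = (C * ((t + 1 : ℕ) : ℝ) - ((t + 1 : ℕ) : ℝ) ^ 2) -
          (C * t - (t : ℝ) ^ 2) := by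
        intro t ht
        have h2 : ((t + 1 : ℕ) : ℝ) ≤ (∑ i, x i : ℕ) := by
          exact_mod_cast (Nat.succ_le_of_lt (Finset.mem_range.1 ht)).trans hi
        push_cast at h2
        simp only [hg]
        rw [max_eq_left (by rw [hC]; push_cast; linarith)]
        push_cast
        ring
      rw [Finset.sum_congr rfl e1, Finset.sum_range_sub (fun t : ℕ => C * (t : ℝ) - (t : ℝ) ^ 2)]
      simp
    rw [Finset.sum_congr rfl fun i _ => this i, Finset.sum_sub_distrib, ← Finset.mul_sum, ← hz]
    push_cast
    rfl
  rw [hsum y hxy.symm, hsum x rfl] at h1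
  linarith

lemma IsEgalitarian.prod_le (hr : ∀ i, IsRank (r i)) (hx : IsEgalitarian σ r x)
    (hy : IsBounded r y) : ∏ i, (y i : ℝ) ≤ ∏ i, (x i : ℝ) := by
  by_cases hy0 : ∃ i, y i = 0
  · obtain ⟨i, hi⟩ := hy0
    rw [Finset.prod_eq_zero (Finset.mem_univ i) (by simp [hi])]
    exact Finset.prod_nonneg fun _ _ => Nat.cast_nonneg _
  push Not at hy0
  -- the number of positive entries of `x` is at least that of `y`
  have hx0 : ∀ i, x i ≠ 0 := by
    have h1 := hx.sum_weights_le hr hy (fun u => if u ≤ 0 then 1 else 0) (fun a b h => by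
      dsimp only
      split_ifs with h1 h2
      · exact le_rfl
      · exact absurd (h.trans h1) h2
      · exact zero_le_one
      · exact le_rfl) (fun u => by split_ifs <;> norm_num)
    have hsum : ∀ z : Fin n → ℕ,
        ∑ i, ∑ t ∈ Finset.range (z i), (if (t : ℝ) ≤ 0 then (1 : ℝ) else 0) =
          ∑ i, if z i = 0 then 0 else 1 := by
      intro z
      refine Finset.sum_congr rfl fun i _ => ?_
      rcases z i with _ | k
      · simp
      · simp
    rw [hsum, hsum] at h1
    intro i hi
    have h2 : ∑ i, (if x i = 0 then (0 : ℝ) else 1) < ∑ i, if y i = 0 then (0 : ℝ) else 1 := by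
      refine Finset.sum_lt_sum (fun j _ => ?_) ⟨i, Finset.mem_univ i, by simp [hi, hy0 i]⟩
      rw [if_neg (hy0 j)]
      split_ifs <;> norm_num
    linarith
  -- `log` is the sum of its decreasing increments
  set g : ℝ → ℝ := fun u => Real.log (1 + 1 / max u 1) with hg
  have hpos : ∀ u : ℝ, 0 < max u 1 := fun u => lt_of_lt_of_le one_pos (le_max_right _ _)
  have h1 := hx.sum_weights_le hr hy g (fun a b h => by
      refine Real.log_le_log (by have := hpos b; positivity) ?_
      have := one_div_le_one_div_of_le (hpos a) (max_le_max h (le_refl (1 : ℝ)))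
      linarith) (fun u => Real.log_nonneg (by
      have := hpos u
      have : 0 ≤ 1 / max u 1 := by positivity
      linarith))
  have hlog : ∀ k : ℕ, ∑ t ∈ Finset.range (k + 1), g t = Real.log 2 + Real.log (k + 1) := by
    intro k
    induction k with
    | zero => simp [hg]; norm_num
    | succ k ih =>
      rw [Finset.sum_range_succ, ih, add_assoc]
      congr 1
      have hk : max ((k + 1 : ℕ) : ℝ) 1 = k + 1 := by
        rw [max_eq_left]
        · push_cast; rfl
        · push_cast; linarith [(Nat.cast_nonneg k : (0 : ℝ) ≤ k)]
      have hk0 : (0 : ℝ) < k + 1 := by positivity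
      simp only [hg, hk]
      rw [← Real.log_mul (by positivity) (by positivity)]
      congr 1
      push_cast
      field_simp
  have hsum : ∀ z : Fin n → ℕ, (∀ i, z i ≠ 0) →
      ∑ i, ∑ t ∈ Finset.range (z i), g t = n * Real.log 2 + ∑ i, Real.log (z i) := by
    intro z hz
    have : ∀ i, ∑ t ∈ Finset.range (z i), g t = Real.log 2 + Real.log (z i) := by
      intro i
      obtain ⟨k, hk⟩ := Nat.exists_eq_succ_of_ne_zero (hz i)
      rw [hk, Nat.succ_eq_add_one, hlog]
      push_cast
      rfl
    rw [Finset.sum_congr rfl fun i _ => this i, Finset.sum_add_distrib]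
    simp
  rw [hsum y hy0, hsum x hx0, add_le_add_iff_left,
    ← Real.log_prod fun i _ => by exact_mod_cast hy0 i,
    ← Real.log_prod fun i _ => by exact_mod_cast hx0 i] at h1
  exact (Real.log_le_log_iff
    (Finset.prod_pos fun i _ => by exact_mod_cast Nat.pos_of_ne_zero (hy0 i))
    (Finset.prod_pos fun i _ => by exact_mod_cast Nat.pos_of_ne_zero (hx0 i))).1 h1

end Lorenz

/-! ### Prioritized egalitarian allocations -/

section PE

variable {n m : ℕ} {σ : Equiv.Perm (Fin n)} {F : Fin n → Valuation (Fin m)}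

/-- The allocation with the given owners of the items. -/
def allocationOf (o : Fin m → Option (Fin n)) : Allocation n (Fin m) where
  bundle := bundleOf o
  disjoint := fun _ _ => disjoint_bundleOf o

/-- Every agent receives her auxiliary item in addition to her bundle. -/
def withAuxiliary (A : Allocation n (Fin m)) : Allocation n (Fin m ⊕ Fin n) where
  bundle i := (A.bundle i).disjSum {i}
  disjoint i j hij := by
    rw [Finset.disjoint_left]
    rintro (a | k) ha hb
    · exact Finset.disjoint_left.1 (A.disjoint i j hij) (by simpa using ha) (by simpa using hb)
    · simp at ha hb
      exact hij (ha.symm.trans hb)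

/-- The bonus that agent `i` obtains from her auxiliary item. -/
def bonus (σ : Equiv.Perm (Fin n)) (i : Fin n) : ℝ := (((σ i : ℕ) : ℝ) + 1) / (n : ℝ) ^ 2

lemma bonus_pos (σ : Equiv.Perm (Fin n)) (i : Fin n) : 0 < bonus σ i := by
  have : (0 : ℝ) < n := by exact_mod_cast i.pos
  unfold bonus
  positivity

lemma bonus_lt_one (hn : 2 ≤ n) (σ : Equiv.Perm (Fin n)) (i : Fin n) : bonus σ i < 1 := by
  have h1 : (2 : ℝ) ≤ n := by exact_mod_cast hn
  have h2 : (((σ i : ℕ) : ℝ) + 1) ≤ n := by exact_mod_cast (σ i).2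
  unfold bonus
  rw [div_lt_one (by positivity)]
  nlinarith

lemma bonus_lt_bonus {i j : Fin n} (h : σ i < σ j) : bonus σ i < bonus σ j := by
  have h1 : (0 : ℝ) < n := by exact_mod_cast i.pos
  have h2 : ((σ i : ℕ) : ℝ) < ((σ j : ℕ) : ℝ) := by exact_mod_cast h
  unfold bonus
  exact div_lt_div_of_pos_right (by linarith) (by positivity)

lemma bonus_injective (σ : Equiv.Perm (Fin n)) : Function.Injective (bonus σ) := by
  intro i j h
  rcases lt_trichotomy (σ i) (σ j) with h1 | h1 | h1
  · exact absurd h (bonus_lt_bonus h1).ne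
  · exact σ.injective h1
  · exact absurd h (bonus_lt_bonus h1).ne'

lemma utility_eq (hF : ∀ i, IsSubmodularDichotomous (F i)) (B : Allocation n (Fin m)) (i : Fin n) :
    utility F B i = (rankOf (F i) (B.bundle i) : ℝ) := ((hF i).coe_rankOf _).symm

lemma isBounded_utility (hF : ∀ i, IsSubmodularDichotomous (F i)) {B : Fin n → Finset (Fin m)}
    (hB : ∀ i j, i ≠ j → Disjoint (B i) (B j)) :
    IsBounded (fun i => rankOf (F i)) fun i => rankOf (F i) (B i) :=
  isBounded_of_bundles (fun i => (hF i).isRank) hB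

lemma IsEgalitarian.levels_bonus (hn : 2 ≤ n) {r : Fin n → Finset (Fin m) → ℕ} {x : Fin n → ℕ}
    (hx : IsEgalitarian σ r x) (i : Fin n) :
    ∃ J : Finset (Fin n), i ∈ J ∧ IsTight r x J ∧
      ∀ j ∈ J, (x j : ℝ) + bonus σ j ≤ x i + bonus σ i + 1 := by
  obtain ⟨J, h1, h2, h3⟩ := hx.2 i
  refine ⟨J, h1, h2, fun j hj => ?_⟩
  rcases h3 j hj with h | ⟨h, h'⟩
  · have e1 : (x j : ℝ) ≤ x i := by exact_mod_cast h
    have e2 := bonus_lt_one hn σ j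
    have e3 := bonus_pos σ i
    linarith
  · have e1 : (x j : ℝ) = x i + 1 := by exact_mod_cast h
    have e2 := bonus_lt_bonus h'
    linarith

/-- The egalitarian allocation with the auxiliary items is Lorenz dominating for the augmented
valuations. -/
lemma isLorenzDominating_withAuxiliary (hn : 2 ≤ n) (hF : ∀ i, IsSubmodularDichotomous (F i))
    {A : Allocation n (Fin m)}
    (hA : IsEgalitarian σ (fun i => rankOf (F i)) fun i => rankOf (F i) (A.bundle i)) :
    IsLorenzDominating (augment σ F) (withAuxiliary A) := by
  intro B
  refine lorenzGE_of_levels (fun i => (hF i).isRank) hA.1 (bonus σ) (hA.levels_bonus hn)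
    (isBounded_utility hF (B := fun i => (B.bundle i).toLeft) ?_) (fun i => ?_) fun i => ?_
  · intro i j hij
    rw [Finset.disjoint_left]
    intro a ha hb
    rw [Finset.mem_toLeft] at ha hb
    exact Finset.disjoint_left.1 (B.disjoint i j hij) ha hb
  · simp [utility, augment, withAuxiliary, bonus, (hF i).coe_rankOf]
  · simp only [utility, augment, (hF i).coe_rankOf]
    have := bonus_pos σ i
    split_ifs
    · rfl
    · linarith

lemma indep_of_isNonRedundant (hF : ∀ i, IsSubmodularDichotomous (F i)) {A : Allocation n (Fin m)}
    (hA : IsNonRedundant F A) (i : Fin n) : Indep (rankOf (F i)) (A.bundle i) := by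
  refine (hF i).isRank.indep_of_erase_lt fun a ha => ?_
  have := hA i a ha
  rw [← (hF i).coe_rankOf, ← (hF i).coe_rankOf] at this
  exact_mod_cast this

lemma isNonRedundant_of_indep (hF : ∀ i, IsSubmodularDichotomous (F i)) {A : Allocation n (Fin m)}
    (hA : ∀ i, Indep (rankOf (F i)) (A.bundle i)) : IsNonRedundant F A := by
  intro i a ha
  rw [← (hF i).coe_rankOf, ← (hF i).coe_rankOf, hA i]
  have h1 := (hF i).isRank.le_card ((A.bundle i).erase a)
  have h2 := Finset.card_erase_lt_of_mem ha
  exact_mod_cast h1.trans_lt h2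

/-- The allocation of the egalitarian mechanism. -/
def egalitarianAllocation (σ : Equiv.Perm (Fin n)) (F : Fin n → Valuation (Fin m)) :
    Allocation n (Fin m) :=
  allocationOf (egalitarianOwner σ fun i => rankOf (F i))

lemma isEgalitarian_egalitarianAllocation (hF : ∀ i, IsSubmodularDichotomous (F i)) :
    IsEgalitarian σ (fun i => rankOf (F i))
      fun i => rankOf (F i) ((egalitarianAllocation σ F).bundle i) := by
  have hr : ∀ i, IsRank (rankOf (F i)) := fun i => (hF i).isRank
  have := isEgalitarian_egalitarianOwner (σ := σ) hr
  convert this using 2 with i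
  exact indep_egalitarianOwner hr i

lemma isPEAllocation_egalitarianAllocation (hn : 2 ≤ n)
    (hF : ∀ i, IsSubmodularDichotomous (F i)) :
    IsPEAllocation σ F (egalitarianAllocation σ F) := by
  refine ⟨isNonRedundant_of_indep hF fun i => indep_egalitarianOwner
    (fun i => (hF i).isRank) i, withAuxiliary (egalitarianAllocation σ F),
    isLorenzDominating_withAuxiliary hn hF (isEgalitarian_egalitarianAllocation hF), fun i => ?_⟩
  simp [withAuxiliary]

/-- All prioritized egalitarian allocations yield the same utilities: the sorted augmented utility
vectors agree, and the fractional part of an augmented utility reveals the agent. -/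
lemma IsPEAllocation.utility_eq (hn : 2 ≤ n) (hF : ∀ i, IsSubmodularDichotomous (F i))
    {A : Allocation n (Fin m)} (hA : IsPEAllocation σ F A) (i : Fin n) :
    rankOf (F i) (A.bundle i) = rankOf (F i) ((egalitarianAllocation σ F).bundle i) := by
  obtain ⟨-, A', hA', hAA'⟩ := hA
  set E := egalitarianAllocation σ F with hE
  have hE' := isLorenzDominating_withAuxiliary hn hF
    (isEgalitarian_egalitarianAllocation (σ := σ) hF)
  have hs := (hA' (withAuxiliary E)).antisymm (hE' A')
  unfold sortedUtility at hs
  set u := utility (augment σ F) A' with hu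
  set w := utility (augment σ F) (withAuxiliary E) with hw
  have hperm : u i = w (Tuple.sort w ((Tuple.sort u).symm i)) := by
    have := congrFun hs ((Tuple.sort u).symm i)
    simpa using this
  set j := Tuple.sort w ((Tuple.sort u).symm i)
  have hwj : w j = (rankOf (F j) (E.bundle j) : ℝ) + bonus σ j := by
    simp [hw, utility, augment, withAuxiliary, bonus, (hF j).coe_rankOf]
  have hui : u i = (rankOf (F i) (A.bundle i) : ℝ) +
      if Sum.inr i ∈ A'.bundle i then bonus σ i else 0 := by
    rw [hAA' i, (hF i).coe_rankOf]
    rfl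
  rw [hwj, hui] at hperm
  have h1 := bonus_pos σ i
  have h2 := bonus_lt_one hn σ i
  have h3 := bonus_pos σ j
  have h4 := bonus_lt_one hn σ j
  -- integers whose difference lies strictly between `-1` and `1` are equal
  have key : ∀ a b : ℕ, (a : ℝ) < b + 1 → (b : ℝ) < a + 1 → a = b := by
    intro a b hab hba
    have e1 : a < b + 1 := by exact_mod_cast hab
    have e2 : b < a + 1 := by exact_mod_cast hba
    omega
  split_ifs at hperm
  · have e := key _ _ (show (rankOf (F i) (A.bundle i) : ℝ) < rankOf (F j) (E.bundle j) + 1 by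
      linarith) (by linarith)
    rw [e] at hperm
    have hij : i = j := bonus_injective σ (by linarith)
    rw [e, ← hij]
  · have e := key _ _ (show (rankOf (F i) (A.bundle i) : ℝ) < rankOf (F j) (E.bundle j) + 1 by
      linarith) (by linarith)
    rw [e] at hperm
    linarith

lemma IsPEAllocation.isEgalitarian (hn : 2 ≤ n) (hF : ∀ i, IsSubmodularDichotomous (F i))
    {A : Allocation n (Fin m)} (hA : IsPEAllocation σ F A) :
    IsEgalitarian σ (fun i => rankOf (F i)) fun i => rankOf (F i) (A.bundle i) := by
  rw [funext fun i => hA.utility_eq hn hF i]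
  exact isEgalitarian_egalitarianAllocation hF

/-! ### Fairness and efficiency -/

variable {A : Allocation n (Fin m)}

lemma isWelfareMaximizing_of_isEgalitarian (hF : ∀ i, IsSubmodularDichotomous (F i))
    (hA : IsEgalitarian σ (fun i => rankOf (F i)) fun i => rankOf (F i) (A.bundle i)) :
    IsWelfareMaximizing F A := by
  intro B
  have := hA.sum_le (fun i => (hF i).isRank) (isBounded_utility hF B.disjoint)
  unfold welfare
  simp only [PrioritizedEgalitarian.utility_eq hF]
  exact_mod_cast this

lemma isLorenzDominating_of_isEgalitarian (hF : ∀ i, IsSubmodularDichotomous (F i))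
    (hA : IsEgalitarian σ (fun i => rankOf (F i)) fun i => rankOf (F i) (A.bundle i)) :
    IsLorenzDominating F A := fun B =>
  lorenzGE_of_levels (fun i => (hF i).isRank) hA.1 (fun _ => 0) hA.levels_zero
    (isBounded_utility hF B.disjoint) (fun i => by simp [PrioritizedEgalitarian.utility_eq hF])
    (fun i => by simp [PrioritizedEgalitarian.utility_eq hF])

lemma isMinSquare_of_isEgalitarian (hF : ∀ i, IsSubmodularDichotomous (F i))
    (hA : IsEgalitarian σ (fun i => rankOf (F i)) fun i => rankOf (F i) (A.bundle i)) :
    IsMinSquare F A := by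
  have hw := isWelfareMaximizing_of_isEgalitarian hF hA
  refine ⟨hw, fun B hB => ?_⟩
  simp only [PrioritizedEgalitarian.utility_eq hF]
  refine hA.sum_sq_le (fun i => (hF i).isRank) (isBounded_utility hF B.disjoint) ?_
  have h := (hB A).antisymm (hw B)
  unfold welfare at h
  simp only [PrioritizedEgalitarian.utility_eq hF] at h
  exact_mod_cast h

lemma isNSWMaximizing_of_isEgalitarian (hF : ∀ i, IsSubmodularDichotomous (F i))
    (hA : IsEgalitarian σ (fun i => rankOf (F i)) fun i => rankOf (F i) (A.bundle i)) :
    IsNSWMaximizing F A := by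
  intro B
  simp only [PrioritizedEgalitarian.utility_eq hF]
  exact hA.prod_le (fun i => (hF i).isRank) (isBounded_utility hF B.disjoint)

/-- Agent `i` takes item `a` from agent `j`. -/
def transfer (A : Allocation n (Fin m)) (i j : Fin n) (a : Fin m) (ha : a ∈ A.bundle j) :
    Allocation n (Fin m) where
  bundle k := if k = i then insert a (A.bundle i) else (A.bundle k).erase a
  disjoint k l hkl := by
    have hne : ∀ k, k ≠ j → a ∉ A.bundle k := fun k hk hak =>
      Finset.disjoint_left.1 (A.disjoint k j hk) hak ha
    rw [Finset.disjoint_left]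
    intro b hb hb'
    have hd := Finset.disjoint_left.1 (A.disjoint k l hkl)
    by_cases hk : k = i
    · have hl : l ≠ i := fun e => hkl (hk.trans e.symm)
      rw [if_pos hk] at hb
      rw [if_neg hl, Finset.mem_erase] at hb'
      exact hd (hk ▸ Finset.mem_of_mem_insert_of_ne hb hb'.1) hb'.2
    · rw [if_neg hk, Finset.mem_erase] at hb
      by_cases hl : l = i
      · rw [if_pos hl] at hb'
        exact hd hb.2 (hl ▸ Finset.mem_of_mem_insert_of_ne hb' hb.1)
      · rw [if_neg hl, Finset.mem_erase] at hb'
        exact hd hb.2 hb'.2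

/-- If `i` envied `j` in spite of the removal of an item, then she could take some item from `j`, and
the sum of squares would decrease. -/
lemma IsMinSquare.isEFX (hF : ∀ i, IsSubmodularDichotomous (F i)) (hmin : IsMinSquare F A)
    (hA : IsNonRedundant F A) : IsEFX F A := by
  intro i j
  by_contra! hc
  obtain ⟨h1, e, he, h2⟩ := hc
  have hij : i ≠ j := by rintro rfl; exact lt_irrefl _ h1
  have hind := indep_of_isNonRedundant hF hA
  rw [← (hF i).coe_rankOf, ← (hF i).coe_rankOf, Nat.cast_lt] at h2
  obtain ⟨a, ha, hlt⟩ := (hF i).isRank.exists_lt_insert h2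
  have haj : a ∈ A.bundle j := Finset.mem_of_mem_erase ha
  have hne : ∀ k, k ≠ j → a ∉ A.bundle k := fun k hk hak =>
    Finset.disjoint_left.1 (A.disjoint k j hk) hak haj
  have hx : rankOf (F i) (A.bundle i) + 2 ≤ rankOf (F j) (A.bundle j) := by
    have e1 := (hF i).isRank.le_card ((A.bundle j).erase e)
    have e2 := Finset.card_erase_add_one he
    have e3 := hind j
    unfold Indep at e3
    omega
  have hui : utility F (transfer A i j a haj) i = utility F A i + 1 := by
    rw [PrioritizedEgalitarian.utility_eq hF, PrioritizedEgalitarian.utility_eq hF]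
    have := (hF i).isRank.insert_le (A.bundle i) a
    simp only [transfer, if_true]
    exact_mod_cast (by omega : rankOf (F i) (insert a (A.bundle i)) =
      rankOf (F i) (A.bundle i) + 1)
  have huj : utility F (transfer A i j a haj) j = utility F A j - 1 := by
    rw [PrioritizedEgalitarian.utility_eq hF, PrioritizedEgalitarian.utility_eq hF,
      eq_sub_iff_add_eq]
    simp only [transfer, if_neg hij.symm]
    rw [(hF j).isRank.indep_subset (hind j) (Finset.erase_subset _ _), hind j,
      ← Finset.card_erase_add_one haj]
    push_cast
    rfl
  have huk : ∀ k, k ≠ i ∧ k ≠ j → utility F (transfer A i j a haj) k = utility F A k := by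
    intro k hk
    simp only [utility, transfer, if_neg hk.1, Finset.erase_eq_of_notMem (hne k hk.2)]
  have hwel : welfare F (transfer A i j a haj) = welfare F A := by
    unfold welfare
    rw [← sub_eq_zero, ← Finset.sum_sub_distrib, Finset.sum_eq_add i j hij
      (fun k _ hk => by rw [huk k hk, sub_self]) (by simp) (by simp), hui, huj]
    ring
  have hsq := hmin.2 (transfer A i j a haj) fun B => by rw [hwel]; exact hmin.1 B
  have hd : ∑ k, utility F (transfer A i j a haj) k ^ 2 - ∑ k, utility F A k ^ 2 =
      2 * (utility F A i - utility F A j + 1) := by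
    rw [← Finset.sum_sub_distrib, Finset.sum_eq_add i j hij
      (fun k _ hk => by rw [huk k hk, sub_self]) (by simp) (by simp), hui, huj]
    ring
  have hx' : utility F A i + 2 ≤ utility F A j := by
    rw [PrioritizedEgalitarian.utility_eq hF, PrioritizedEgalitarian.utility_eq hF]
    exact_mod_cast hx
  linarith

lemma IsEFX.isEF1 (hF : ∀ i, IsSubmodularDichotomous (F i)) (h : IsEFX F A) : IsEF1 F A := by
  intro i j
  rcases h i j with h | h
  · exact Or.inl h
  · rcases (A.bundle j).eq_empty_or_nonempty with he | ⟨a, ha⟩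
    · rw [he]
      exact Or.inl ((hF i).monotone _ _ (Finset.empty_subset _))
    · exact Or.inr ⟨a, ha, h a ha⟩

lemma IsAdditive.sum_eq {f : Valuation (Fin m)} (hf : IsSubmodularDichotomous f)
    (hadd : IsAdditive f) {ι : Type*} [DecidableEq ι] (s : Finset ι) (B : ι → Finset (Fin m))
    (hB : ∀ i j, i ≠ j → Disjoint (B i) (B j)) : f (s.biUnion B) = ∑ i ∈ s, f (B i) := by
  induction s using Finset.induction_on with
  | empty => simpa using hf.normalized
  | insert a s ha ih =>
    rw [Finset.biUnion_insert, Finset.sum_insert ha, ← ih, hadd]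
    rw [Finset.disjoint_biUnion_right]
    exact fun i hi => hB a i fun e => ha (e ▸ hi)

/-- Under additive valuations, an envy-free up to any good, welfare maximizing allocation gives
agent `i` her maximin share: every other bundle is worth at most `f i (A i) + 1` to her, and the
unallocated items are worth nothing, which bounds the value of all items. -/
lemma IsEFX.isMaximinFair (hF : ∀ i, IsSubmodularDichotomous (F i))
    (hadd : ∀ i, IsAdditive (F i)) (hA : IsEFX F A) (hw : IsWelfareMaximizing F A) :
    IsMaximinFair F A := by
  intro i
  have : Nonempty (Fin n) := ⟨i⟩
  refine ciSup_le fun P => ?_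
  by_contra! hc
  set U := (Finset.univ.biUnion A.bundle)ᶜ with hU
  have hUd : ∀ k, Disjoint (A.bundle k) U := by
    intro k
    rw [Finset.disjoint_left]
    intro a ha haU
    exact Finset.mem_compl.1 haU (Finset.mem_biUnion.2 ⟨k, Finset.mem_univ k, ha⟩)
  have hU0 : F i U ≤ 0 := by
    let B : Allocation n (Fin m) :=
      ⟨fun k => if k = i then A.bundle i ∪ U else A.bundle k, by
        intro k l hkl
        split_ifs with h1 h2 h2
        · exact absurd (h1.trans h2.symm) hkl
        · subst h1
          exact Finset.disjoint_union_left.2 ⟨A.disjoint k l hkl, (hUd l).symm⟩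
        · subst h2
          exact Finset.disjoint_union_right.2 ⟨A.disjoint k l hkl, hUd k⟩
        · exact A.disjoint k l hkl⟩
    have h1 := hw B
    have h2 : welfare F B = welfare F A + F i U := by
      unfold welfare
      rw [← Finset.add_sum_erase _ _ (Finset.mem_univ i),
        ← Finset.add_sum_erase _ (utility F A) (Finset.mem_univ i)]
      have : ∑ k ∈ Finset.univ.erase i, utility F B k =
          ∑ k ∈ Finset.univ.erase i, utility F A k :=
        Finset.sum_congr rfl fun k hk => by
          simp [utility, B, if_neg (Finset.ne_of_mem_erase hk)]
      rw [this]
      simp only [utility, B, if_true, ← hadd i _ _ (hUd i)]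
      ring
    linarith
  have huniv : F i Finset.univ = ∑ k, F i (A.bundle k) + F i U := by
    rw [← IsAdditive.sum_eq (hF i) (hadd i) _ _ A.disjoint, hadd i _ _ disjoint_compl_right,
      Finset.union_compl]
  have hother : ∀ k, F i (A.bundle k) ≤ F i (A.bundle i) + 1 := by
    intro k
    rcases hA i k with h | h
    · linarith
    · rcases (A.bundle k).eq_empty_or_nonempty with he | ⟨a, ha⟩
      · rw [he]
        have := (hF i).monotone ∅ (A.bundle i) (Finset.empty_subset _)
        linarith
      · have h1 := h a ha
        have h2 := (hF i).isRank.insert_le ((A.bundle k).erase a) a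
        rw [Finset.insert_erase ha] at h2
        have h3 : (rankOf (F i) (A.bundle k) : ℝ) ≤ rankOf (F i) ((A.bundle k).erase a) + 1 := by
          exact_mod_cast h2
        rw [(hF i).coe_rankOf, (hF i).coe_rankOf] at h3
        linarith
  have hbundle : ∀ j, F i (A.bundle i) + 1 ≤ F i (Finset.univ.filter fun a => P a = j) := by
    intro j
    have h1 := hc.trans_le (ciInf_le (Set.finite_range _).bddBelow j)
    rw [← (hF i).coe_rankOf, ← (hF i).coe_rankOf, Nat.cast_lt] at h1
    rw [← (hF i).coe_rankOf, ← (hF i).coe_rankOf]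
    exact_mod_cast h1
  have hpart : F i Finset.univ = ∑ j, F i (Finset.univ.filter fun a => P a = j) := by
    rw [← IsAdditive.sum_eq (hF i) (hadd i)]
    · congr 1
      ext a
      simp
    · intro j k hjk
      rw [Finset.disjoint_left]
      intro a ha hb
      exact hjk ((Finset.mem_filter.1 ha).2.symm.trans (Finset.mem_filter.1 hb).2)
  have hlt : ∑ k, F i (A.bundle k) < ∑ _k : Fin n, (F i (A.bundle i) + 1) :=
    Finset.sum_lt_sum (fun k _ => hother k) ⟨i, Finset.mem_univ i, by linarith⟩
  have hle := Finset.sum_le_sum fun j (_ : j ∈ Finset.univ) => hbundle j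
  linarith

/-! ### Truthfulness -/

lemma IsPEMechanism.isTruthful (hn : 2 ≤ n) {M : Mechanism n (Fin m)} (hM : IsPEMechanism σ M) :
    IsTruthful M := by
  intro i f hf r g
  set F := fun j => legalize (Function.update r i f j) with hFdef
  set G := fun j => legalize (Function.update r i g j) with hGdef
  have hF : ∀ j, IsSubmodularDichotomous (F j) := fun j => isSubmodularDichotomous_legalize _
  have hG : ∀ j, IsSubmodularDichotomous (G j) := fun j => isSubmodularDichotomous_legalize _
  have hA : IsPEAllocation σ F (M (Function.update r i f)) := hM _
  have hB : IsPEAllocation σ G (M (Function.update r i g)) := hM _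
  set A := M (Function.update r i f)
  set B := M (Function.update r i g)
  have hFi : F i = f := by simp [hFdef, legalize_eq_self hf]
  have hFG : ∀ j, j ≠ i → rankOf (F j) = rankOf (G j) := by
    intro j hj
    simp only [hFdef, hGdef, Function.update_of_ne hj]
  have h := (hA.isEgalitarian hn hF).le_of_update (i := i) (s := rankOf (F i) (B.bundle i))
    (fun j => (hF j).isRank) (fun j => (hG j).isRank) hFG (hB.isEgalitarian hn hG)
    (by
      have h1 := indep_of_isNonRedundant hG hB.1 i
      have h2 := (hF i).isRank.le_card (B.bundle i)
      unfold Indep at h1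
      omega)
    (by
      convert isBounded_utility hF B.disjoint using 1
      funext j
      by_cases hj : j = i
      · subst hj; simp
      · rw [Function.update_of_ne hj, hFG j hj])
  rw [← hFi, ← (hF i).coe_rankOf, ← (hF i).coe_rankOf]
  exact_mod_cast h

end PE

/-! ### Closure properties of polynomial time -/

lemma eval_le_eval (q : Polynomial ℕ) {a b : ℕ} (h : a ≤ b) : q.eval a ≤ q.eval b := by
  rw [Polynomial.eval_eq_sum_range, Polynomial.eval_eq_sum_range]
  exact Finset.sum_le_sum fun i _ => Nat.mul_le_mul_left _ (Nat.pow_le_pow_left h i)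

lemma BinTree.size_pos (x : BinTree) : 0 < x.size := by cases x <;> simp [BinTree.size]

/-- The time of a run exceeds the size of the input and is at least the size of the output. -/
lemma Run.size_le {p : Prog} {x y : BinTree} {t : ℕ} (h : Run p x y t) :
    x.size < t ∧ y.size ≤ t := by
  induction h with
  | skip x => omega
  | nil x => have := x.size_pos; simp [BinTree.size]
  | left x => cases x <;> simp [BinTree.size, BinTree.left]; omega
  | right x => cases x <;> simp [BinTree.size, BinTree.right]; omega
  | pair _ _ ih1 ih2 => simp only [BinTree.size]; omega
  | comp _ _ ih1 ih2 => omega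
  | cond_true _ _ ih1 ih2 => omega
  | cond_false _ _ ih1 ih2 => omega
  | loop_stop _ ih => omega
  | loop_step _ _ _ ih1 ih2 ih3 => omega

section

variable {ι κ : Type*} {inp : ι → BinTree}

/-- The numbers `b i` are bounded by a polynomial in the size of the input. -/
def PolyBounded (inp : ι → BinTree) (b : ι → ℕ) : Prop :=
  ∃ q : Polynomial ℕ, ∀ i, b i ≤ q.eval (inp i).size

lemma PolyBounded.mono {a b : ι → ℕ} (hb : PolyBounded inp b) (h : ∀ i, a i ≤ b i) :
    PolyBounded inp a := by
  obtain ⟨q, hq⟩ := hb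
  exact ⟨q, fun i => (h i).trans (hq i)⟩

lemma PolyBounded.const (c : ℕ) : PolyBounded inp fun _ => c :=
  ⟨Polynomial.C c, fun _ => by simp⟩

lemma PolyBounded.size : PolyBounded inp fun i => (inp i).size :=
  ⟨Polynomial.X, fun _ => by simp⟩

lemma PolyBounded.add {a b : ι → ℕ} (ha : PolyBounded inp a) (hb : PolyBounded inp b) :
    PolyBounded inp fun i => a i + b i := by
  obtain ⟨p, hp⟩ := ha
  obtain ⟨q, hq⟩ := hb
  exact ⟨p + q, fun i => by rw [Polynomial.eval_add]; exact add_le_add (hp i) (hq i)⟩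

lemma PolyBounded.mul {a b : ι → ℕ} (ha : PolyBounded inp a) (hb : PolyBounded inp b) :
    PolyBounded inp fun i => a i * b i := by
  obtain ⟨p, hp⟩ := ha
  obtain ⟨q, hq⟩ := hb
  exact ⟨p * q, fun i => by rw [Polynomial.eval_mul]; exact Nat.mul_le_mul (hp i) (hq i)⟩

lemma PolyBounded.eval {b : ι → ℕ} (hb : PolyBounded inp b) (q : Polynomial ℕ) :
    PolyBounded inp fun i => q.eval (b i) := by
  obtain ⟨p, hp⟩ := hb
  exact ⟨q.comp p, fun i => by rw [Polynomial.eval_comp]; exact eval_le_eval q (hp i)⟩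

lemma solvableInPolyTime_iff {out : ι → BinTree} :
    SolvableInPolyTime inp out ↔ ∃ (p : Prog) (b : ι → ℕ), PolyBounded inp b ∧
      ∀ i, ∃ t, Run p (inp i) (out i) t ∧ t ≤ b i := by
  constructor
  · rintro ⟨p, q, h⟩
    exact ⟨p, _, ⟨q, fun _ => le_rfl⟩, h⟩
  · rintro ⟨p, b, ⟨q, hq⟩, h⟩
    refine ⟨p, q, fun i => ?_⟩
    obtain ⟨t, h1, h2⟩ := h i
    exact ⟨t, h1, h2.trans (hq i)⟩

namespace SolvableInPolyTime

variable {f g : ι → BinTree}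

lemma polyBounded (h : SolvableInPolyTime inp f) : PolyBounded inp fun i => (f i).size := by
  obtain ⟨p, q, h⟩ := h
  refine ⟨q, fun i => ?_⟩
  obtain ⟨t, h1, h2⟩ := h i
  exact h1.size_le.2.trans h2

lemma of_eq (h : SolvableInPolyTime inp f) (e : ∀ i, f i = g i) : SolvableInPolyTime inp g :=
  (funext e : f = g) ▸ h

protected lemma id : SolvableInPolyTime inp inp :=
  solvableInPolyTime_iff.2 ⟨.skip, _, .add .size (.const 1), fun _ => ⟨_, .skip _, le_rfl⟩⟩

protected lemma nil : SolvableInPolyTime inp fun _ => .nil :=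
  solvableInPolyTime_iff.2 ⟨.nil, _, .add .size (.const 1), fun _ => ⟨_, .nil _, le_rfl⟩⟩

protected lemma comp {mid out : ι → BinTree} (h2 : SolvableInPolyTime mid out)
    (h1 : SolvableInPolyTime inp mid) : SolvableInPolyTime inp out := by
  have hmid := h1.polyBounded
  obtain ⟨p, b, hb, hp⟩ := solvableInPolyTime_iff.1 h1
  obtain ⟨r, q, hr⟩ := h2
  refine solvableInPolyTime_iff.2 ⟨.comp r p, _, .add (.add hb (hmid.eval q)) (.const 1),
    fun i => ?_⟩
  obtain ⟨s, hs1, hs2⟩ := hp i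
  obtain ⟨t, ht1, ht2⟩ := hr i
  exact ⟨_, .comp hs1 ht1, by omega⟩

/-- A problem that is solvable on the indices in the range of `e`. -/
lemma reindex (h : SolvableInPolyTime inp f) (e : κ → ι) :
    SolvableInPolyTime (fun k => inp (e k)) fun k => f (e k) := by
  obtain ⟨p, q, h⟩ := h
  exact ⟨p, q, fun k => h (e k)⟩

/-- A computable function of computable data. -/
lemma pull {inp' : κ → BinTree} (h : SolvableInPolyTime inp f) (e : κ → ι)
    (h' : SolvableInPolyTime inp' fun k => inp (e k)) :
    SolvableInPolyTime inp' fun k => f (e k) :=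
  (h.reindex e).comp h'

protected lemma left (h : SolvableInPolyTime inp f) : SolvableInPolyTime inp fun i => (f i).left :=
  SolvableInPolyTime.comp
    (solvableInPolyTime_iff.2 ⟨.left, _, .add .size (.const 1), fun _ => ⟨_, .left _, le_rfl⟩⟩) h

protected lemma right (h : SolvableInPolyTime inp f) :
    SolvableInPolyTime inp fun i => (f i).right :=
  SolvableInPolyTime.comp
    (solvableInPolyTime_iff.2 ⟨.right, _, .add .size (.const 1), fun _ => ⟨_, .right _, le_rfl⟩⟩) h

protected lemma cons (hf : SolvableInPolyTime inp f) (hg : SolvableInPolyTime inp g) :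
    SolvableInPolyTime inp fun i => .cons (f i) (g i) := by
  obtain ⟨p, a, ha, hp⟩ := solvableInPolyTime_iff.1 hf
  obtain ⟨q, b, hb, hq⟩ := solvableInPolyTime_iff.1 hg
  refine solvableInPolyTime_iff.2 ⟨.pair p q, _, .add (.add ha hb) (.const 1), fun i => ?_⟩
  obtain ⟨s, hs1, hs2⟩ := hp i
  obtain ⟨t, ht1, ht2⟩ := hq i
  exact ⟨_, .pair hs1 ht1, by omega⟩

lemma fst (h : SolvableInPolyTime inp fun i => .cons (f i) (g i)) : SolvableInPolyTime inp f :=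
  h.left

lemma snd (h : SolvableInPolyTime inp fun i => .cons (f i) (g i)) : SolvableInPolyTime inp g :=
  h.right

/-- Case distinction by a test. -/
lemma cases {c out : ι → BinTree} (hc : SolvableInPolyTime inp c)
    (h1 : SolvableInPolyTime (fun i : {i // c i ≠ .nil} => inp i) fun i => out i)
    (h2 : SolvableInPolyTime (fun i : {i // c i = .nil} => inp i) fun i => out i) :
    SolvableInPolyTime inp out := by
  obtain ⟨p, a, ha, hp⟩ := solvableInPolyTime_iff.1 hc
  obtain ⟨q1, b1, hq1⟩ := h1
  obtain ⟨q2, b2, hq2⟩ := h2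
  refine solvableInPolyTime_iff.2 ⟨.cond p q1 q2, _,
    .add (.add ha (.add (PolyBounded.size.eval b1) (PolyBounded.size.eval b2))) (.const 1),
    fun i => ?_⟩
  obtain ⟨s, hs1, hs2⟩ := hp i
  rcases hci : c i with _ | ⟨a, b⟩
  · rw [hci] at hs1
    obtain ⟨t, ht1, ht2⟩ := hq2 ⟨i, hci⟩
    exact ⟨_, .cond_false hs1 ht1, by dsimp only at ht2; omega⟩
  · rw [hci] at hs1
    obtain ⟨t, ht1, ht2⟩ := hq1 ⟨i, by rw [hci]; exact BinTree.noConfusion⟩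
    exact ⟨_, .cond_true hs1 ht1, by dsimp only at ht2; omega⟩

/-- A loop whose counter is a tree that loses its first element in every round.  The state type `S i`
is encoded by `enc`, and the invariant `Inv` guarantees that the encodings stay small. -/
lemma countdown {K : ι → ℕ} {S : ι → Type*} (cnt : ι → ℕ → BinTree)
    (enc : ∀ i, S i → BinTree) (step : ∀ i, Fin (K i) → S i → S i) (init : ∀ i, S i)
    (Inv : ∀ i, ℕ → S i → Prop) {B : ι → ℕ} (hcnt0 : ∀ i, cnt i 0 = .nil)
    (hcnt : ∀ i (k : Fin (K i)), ∃ a, cnt i (k + 1) = .cons a (cnt i k))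
    (h0 : ∀ i, Inv i (K i) (init i))
    (hs : ∀ i (k : Fin (K i)) (s : S i), Inv i (k + 1) s → Inv i k (step i k s))
    (hB : PolyBounded inp B) (hInv : ∀ i k s, Inv i k s → (enc i s).size ≤ B i)
    (hK : SolvableInPolyTime inp fun i => cnt i (K i))
    (hinit : SolvableInPolyTime inp fun i => enc i (init i))
    (hstep : SolvableInPolyTime (ι := (i : ι) × Fin (K i) × S i)
      (fun x => .cons (cnt x.1 x.2.1) (.cons (enc x.1 x.2.2) (inp x.1)))
      fun x => enc x.1 (step x.1 x.2.1 x.2.2)) :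
    SolvableInPolyTime inp fun i => enc i (Fin.foldr (K i) (step i) (init i)) := by
  -- the size of the counter is at least the number of rounds, and decreases
  have hsize : ∀ i k, k ≤ K i → k ≤ (cnt i k).size ∧ (cnt i k).size ≤ (cnt i (K i)).size := by
    intro i k hk
    constructor
    · induction k with
      | zero => exact Nat.zero_le _
      | succ k ih =>
        obtain ⟨a, ha⟩ := hcnt i ⟨k, hk⟩
        dsimp only at ha
        rw [ha]
        have := ih (by omega)
        simp only [BinTree.size]
        omega
    · have : ∀ d, ∀ k, k + d = K i → (cnt i k).size ≤ (cnt i (K i)).size := by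
        intro d
        induction d with
        | zero => rintro k rfl; exact le_rfl
        | succ d ih =>
          intro k hk
          refine le_trans ?_ (ih (k + 1) (by omega))
          obtain ⟨a, ha⟩ := hcnt i ⟨k, by omega⟩
          dsimp only at ha
          rw [ha]
          simp only [BinTree.size]
          omega
      exact this (K i - k) k (by omega)
  have hbody : SolvableInPolyTime
      (ι := (i : ι) × Fin (K i) × S i)
      (fun x => .cons (cnt x.1 (x.2.1 + 1)) (.cons (enc x.1 x.2.2) (inp x.1)))
      fun x => .cons (cnt x.1 x.2.1)
        (.cons (enc x.1 (step x.1 x.2.1 x.2.2)) (inp x.1)) := by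
    have hdec : SolvableInPolyTime (ι := (i : ι) × Fin (K i) × S i)
        (fun x => .cons (cnt x.1 (x.2.1 + 1)) (.cons (enc x.1 x.2.2) (inp x.1)))
        fun x => .cons (cnt x.1 x.2.1) (.cons (enc x.1 x.2.2) (inp x.1)) := by
      refine (SolvableInPolyTime.id.fst.right.cons SolvableInPolyTime.id.snd).of_eq fun x => ?_
      obtain ⟨a, ha⟩ := hcnt x.1 x.2.1
      rw [ha]
      rfl
    exact SolvableInPolyTime.comp
      (SolvableInPolyTime.id.fst.cons (hstep.cons SolvableInPolyTime.id.snd.snd)) hdec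
  obtain ⟨p, q, hp⟩ := hbody
  -- a bound `N` for the size of the trees in the loop
  set N : ι → ℕ := fun i => (cnt i (K i)).size + (B i + (inp i).size + 1) + 1 with hN
  have hNpoly : PolyBounded inp N :=
    .add (.add hK.polyBounded (.add (.add hB .size) (.const 1))) (.const 1)
  have hNsize : ∀ i k s, k ≤ K i → Inv i k s →
      (BinTree.cons (cnt i k) (.cons (enc i s) (inp i))).size ≤ N i := by
    intro i k s hk hs
    have h1 := (hsize i k hk).2
    have h2 := hInv i k s hs
    simp only [BinTree.size, hN]
    omega
  have hloop : ∀ i k (hk : k ≤ K i) (s : S i), Inv i k s → ∃ t,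
      Run (.loop .left p) (.cons (cnt i k) (.cons (enc i s) (inp i)))
        (.cons .nil (.cons (enc i (Fin.foldr.loop (K i) (step i) k hk s)) (inp i))) t ∧
      t ≤ (k + 1) * (N i + q.eval (N i) + 2) := by
    intro i k
    induction k with
    | zero =>
      intro hk s hs
      have h1 := hNsize i 0 s hk hs
      rw [hcnt0] at h1 ⊢
      exact ⟨_, Run.loop_stop (Run.left (.cons .nil _)), by omega⟩
    | succ k ih =>
      intro hk s hs'
      obtain ⟨t, ht1, ht2⟩ := ih (by omega) _ (hs i ⟨k, hk⟩ s hs')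
      obtain ⟨u, hu1, hu2⟩ := hp ⟨i, ⟨k, hk⟩, s⟩
      have h1 := hNsize i (k + 1) s hk hs'
      have h2 := hu2.trans (eval_le_eval q h1)
      obtain ⟨a, ha⟩ := hcnt i ⟨k, hk⟩
      dsimp only at ha
      have hleft := Run.left (.cons (cnt i (k + 1)) (.cons (enc i s) (inp i)))
      simp only [BinTree.left] at hleft
      nth_rewrite 2 [ha] at hleft
      refine ⟨_, .loop_step hleft hu1 ht1, ?_⟩
      rw [add_mul (k + 1) 1, one_mul]
      omega
  have hmain : SolvableInPolyTime (fun i => .cons (cnt i (K i)) (.cons (enc i (init i)) (inp i)))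
      fun i => .cons .nil (.cons (enc i (Fin.foldr (K i) (step i) (init i))) (inp i)) := by
    obtain ⟨q', hq'⟩ : PolyBounded inp fun i => (K i + 1) * (N i + q.eval (N i) + 2) :=
      .mul (.add (hK.polyBounded.mono fun i => (hsize i _ le_rfl).1) (.const 1))
        (.add (.add hNpoly (hNpoly.eval q)) (.const 2))
    refine ⟨.loop .left p, q', fun i => ?_⟩
    obtain ⟨t, ht1, ht2⟩ := hloop i (K i) le_rfl (init i) (h0 i)
    refine ⟨t, ht1, ht2.trans ((hq' i).trans (eval_le_eval q' ?_))⟩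
    simp only [BinTree.size]
    omega
  exact (hmain.comp (hK.cons (hinit.cons .id))).snd.fst

end SolvableInPolyTime

/-! ### Numbers, truth values, lists and options -/

lemma size_encodeNat (k : ℕ) : (encodeNat k).size = 2 * k + 1 := by
  induction k with
  | zero => rfl
  | succ k ih => simp only [encodeNat, BinTree.size, ih]; ring

lemma encodeProp_ne_nil {P : Prop} : encodeProp P ≠ .nil ↔ P := by
  unfold encodeProp
  split_ifs with h <;> simp [encodeNat, h]

lemma encodeProp_eq_nil {P : Prop} : encodeProp P = .nil ↔ ¬ P := by
  rw [← not_iff_not, not_not]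
  exact encodeProp_ne_nil

lemma encodeProp_true {P : Prop} (h : P) : encodeProp P = .cons .nil .nil := by
  simp [encodeProp, h, encodeNat]

lemma encodeProp_false {P : Prop} (h : ¬ P) : encodeProp P = .nil := encodeProp_eq_nil.2 h

lemma encodeList_ofFn (K : ℕ) (g : Fin K → BinTree) :
    encodeList (List.ofFn g) = Fin.foldr K (fun k acc => .cons (g k) acc) .nil := by
  induction K with
  | zero => simp [encodeList]
  | succ K ih => rw [List.ofFn_succ, Fin.foldr_succ, encodeList, ih]

lemma size_encodeList_ofFn_le {K c : ℕ} {g : Fin K → BinTree} (h : ∀ k, (g k).size ≤ c) :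
    (encodeList (List.ofFn g)).size ≤ K * (c + 1) + 1 := by
  induction K with
  | zero => simp [encodeList, BinTree.size]
  | succ K ih =>
    rw [List.ofFn_succ, encodeList]
    have h1 := ih fun k => h k.succ
    have h2 := h 0
    simp only [BinTree.size]
    rw [add_mul]
    omega

lemma length_le_size_encodeList (l : List BinTree) : l.length ≤ (encodeList l).size := by
  induction l with
  | nil => exact Nat.zero_le _
  | cons x l ih =>
    simp only [encodeList, BinTree.size, List.length_cons]
    omega

/-- Options of indices, as numbers: `none` is `0`, and `some j` is `j + 1`. -/
def optionCode {K : ℕ} (o : Option (Fin K)) : ℕ := o.elim 0 fun j => j + 1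

lemma optionCode_eq_iff {K : ℕ} (o : Option (Fin K)) (j : Fin K) :
    optionCode o = j + 1 ↔ o = some j := by
  cases o <;> simp [optionCode, Fin.ext_iff]

lemma optionCode_eq_zero {K : ℕ} (o : Option (Fin K)) : optionCode o = 0 ↔ o = none := by
  cases o <;> simp [optionCode]

lemma optionCode_le {K : ℕ} (o : Option (Fin K)) : optionCode o ≤ K := by
  cases o <;> simp [optionCode]

/-- Options of indices, encoded in unary by their code. -/
def encodeOption {K : ℕ} (o : Option (Fin K)) : BinTree := encodeNat (optionCode o)

lemma size_encodeOption_le {K : ℕ} (o : Option (Fin K)) : (encodeOption o).size ≤ 2 * K + 1 := by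
  have := optionCode_le o
  rw [encodeOption, size_encodeNat]
  omega

namespace SolvableInPolyTime

lemma zero : SolvableInPolyTime inp fun _ => encodeNat 0 := SolvableInPolyTime.nil

lemma succ {a : ι → ℕ} (h : SolvableInPolyTime inp fun i => encodeNat (a i)) :
    SolvableInPolyTime inp fun i => encodeNat (a i + 1) :=
  SolvableInPolyTime.nil.cons h

lemma pred {a : ι → ℕ} (h : SolvableInPolyTime inp fun i => encodeNat (a i)) :
    SolvableInPolyTime inp fun i => encodeNat (a i - 1) :=
  h.right.of_eq fun i => by cases a i <;> rfl

lemma polyBounded_nat {a : ι → ℕ} (h : SolvableInPolyTime inp fun i => encodeNat (a i)) :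
    PolyBounded inp a :=
  h.polyBounded.mono fun i => by rw [size_encodeNat]; omega

/-- A loop counting down, with states of polynomial size. -/
lemma foldr {K : ι → ℕ} {S : ι → Type*} (enc : ∀ i, S i → BinTree)
    (step : ∀ i, Fin (K i) → S i → S i) (init : ∀ i, S i)
    {B : ι → ℕ} (hB : PolyBounded inp B) (hInv : ∀ i s, (enc i s).size ≤ B i)
    (hK : SolvableInPolyTime inp fun i => encodeNat (K i))
    (hinit : SolvableInPolyTime inp fun i => enc i (init i))
    (hstep : SolvableInPolyTime (ι := (i : ι) × Fin (K i) × S i)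
      (fun x => .cons (encodeNat x.2.1) (.cons (enc x.1 x.2.2) (inp x.1)))
      fun x => enc x.1 (step x.1 x.2.1 x.2.2)) :
    SolvableInPolyTime inp fun i => enc i (Fin.foldr (K i) (step i) (init i)) :=
  countdown (fun _ => encodeNat) enc step init (fun _ _ _ => True) (fun _ => rfl)
    (fun _ _ => ⟨_, rfl⟩) (fun _ => trivial) (fun _ _ _ _ => trivial) hB
    (fun i _ s _ => hInv i s) hK hinit hstep

lemma sub {a b : ι → ℕ} (ha : SolvableInPolyTime inp fun i => encodeNat (a i))
    (hb : SolvableInPolyTime inp fun i => encodeNat (b i)) :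
    SolvableInPolyTime inp fun i => encodeNat (a i - b i) := by
  have := countdown (K := b) (S := fun _ => ℕ) (fun _ => encodeNat) (fun _ => encodeNat)
    (fun _ _ s => s - 1) a (fun i _ s => s ≤ a i) (fun _ => rfl) (fun _ _ => ⟨_, rfl⟩)
    (fun _ => le_rfl) (fun _ _ s h => (Nat.sub_le s 1).trans h) ha.polyBounded
    (fun i k s h => by rw [size_encodeNat, size_encodeNat]; omega) hb ha
    (SolvableInPolyTime.id.snd.fst.pred)
  refine this.of_eq fun i => congrArg encodeNat ?_
  rw [fin_foldr_const]
  induction b i with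
  | zero => rfl
  | succ k ih => rw [Function.iterate_succ_apply', ih]; rfl

lemma prop_cases {P : ι → Prop} {out : ι → BinTree}
    (hP : SolvableInPolyTime inp fun i => encodeProp (P i))
    (h1 : SolvableInPolyTime (fun i : {i // P i} => inp i) fun i => out i)
    (h2 : SolvableInPolyTime (fun i : {i // ¬ P i} => inp i) fun i => out i) :
    SolvableInPolyTime inp out :=
  hP.cases
    (h1.reindex fun i : {i // encodeProp (P i) ≠ .nil} => ⟨i.1, encodeProp_ne_nil.1 i.2⟩)
    (h2.reindex fun i : {i // encodeProp (P i) = .nil} => ⟨i.1, encodeProp_eq_nil.1 i.2⟩)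

lemma ite {P : ι → Prop} [DecidablePred P] {f g : ι → BinTree}
    (hP : SolvableInPolyTime inp fun i => encodeProp (P i)) (hf : SolvableInPolyTime inp f)
    (hg : SolvableInPolyTime inp g) :
    SolvableInPolyTime inp fun i => if P i then f i else g i := by
  refine hP.prop_cases ((hf.reindex Subtype.val).of_eq ?_) ((hg.reindex Subtype.val).of_eq ?_)
  · exact fun i => (if_pos i.2).symm
  · exact fun i => (if_neg i.2).symm

/-- The truth value of a property that is recognized by the value `nil` of a test. -/
lemma of_test {c : ι → BinTree} {P : ι → Prop} (hc : SolvableInPolyTime inp c)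
    (h : ∀ i, P i ↔ c i = .nil) : SolvableInPolyTime inp fun i => encodeProp (P i) :=
  hc.cases (SolvableInPolyTime.nil.of_eq fun i =>
      (encodeProp_false fun hP => i.2 ((h i).1 hP)).symm)
    ((SolvableInPolyTime.nil.cons SolvableInPolyTime.nil).of_eq fun i =>
      (encodeProp_true ((h i).2 i.2)).symm)

lemma not {P : ι → Prop} (hP : SolvableInPolyTime inp fun i => encodeProp (P i)) :
    SolvableInPolyTime inp fun i => encodeProp (¬ P i) :=
  hP.of_test fun _ => encodeProp_eq_nil.symm

lemma and {P Q : ι → Prop} (hP : SolvableInPolyTime inp fun i => encodeProp (P i))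
    (hQ : SolvableInPolyTime inp fun i => encodeProp (Q i)) :
    SolvableInPolyTime inp fun i => encodeProp (P i ∧ Q i) :=
  hP.prop_cases ((hQ.reindex _).of_eq fun i => by simp [i.2])
    (SolvableInPolyTime.nil.of_eq fun i => (encodeProp_false fun h => i.2 h.1).symm)

lemma or {P Q : ι → Prop} (hP : SolvableInPolyTime inp fun i => encodeProp (P i))
    (hQ : SolvableInPolyTime inp fun i => encodeProp (Q i)) :
    SolvableInPolyTime inp fun i => encodeProp (P i ∨ Q i) :=
  (hP.not.and hQ.not).not.of_eq fun i => congrArg encodeProp (by simp only [eq_iff_iff]; tauto)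

lemma le {a b : ι → ℕ} (ha : SolvableInPolyTime inp fun i => encodeNat (a i))
    (hb : SolvableInPolyTime inp fun i => encodeNat (b i)) :
    SolvableInPolyTime inp fun i => encodeProp (a i ≤ b i) :=
  (ha.sub hb).of_test fun i => by
    rw [← Nat.sub_eq_zero_iff_le]
    cases a i - b i <;> simp [encodeNat]

lemma lt {a b : ι → ℕ} (ha : SolvableInPolyTime inp fun i => encodeNat (a i))
    (hb : SolvableInPolyTime inp fun i => encodeNat (b i)) :
    SolvableInPolyTime inp fun i => encodeProp (a i < b i) :=
  ha.succ.le hb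

protected lemma eq {a b : ι → ℕ} (ha : SolvableInPolyTime inp fun i => encodeNat (a i))
    (hb : SolvableInPolyTime inp fun i => encodeNat (b i)) :
    SolvableInPolyTime inp fun i => encodeProp (a i = b i) :=
  ((ha.le hb).and (hb.le ha)).of_eq fun i => congrArg encodeProp (by
    simp only [eq_iff_iff]; omega)

/-- Tabulation of a function. -/
lemma ofFn {K : ι → ℕ} {g : ∀ i, Fin (K i) → BinTree}
    (hK : SolvableInPolyTime inp fun i => encodeNat (K i))
    (hg : SolvableInPolyTime (ι := (i : ι) × Fin (K i))
      (fun x => .cons (encodeNat x.2) (inp x.1)) fun x => g x.1 x.2) :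
    SolvableInPolyTime inp fun i => encodeList (List.ofFn (g i)) := by
  obtain ⟨q, hq⟩ := hg.polyBounded
  set c : ι → ℕ := fun i => q.eval (2 * K i + 1 + (inp i).size + 1) with hc
  have hcpoly : PolyBounded inp c := PolyBounded.eval
    (.add (.add (.add (.mul (.const 2) hK.polyBounded_nat) (.const 1)) .size) (.const 1)) q
  have hgc : ∀ i k, (g i k).size ≤ c i := by
    intro i k
    refine (hq ⟨i, k⟩).trans (eval_le_eval q ?_)
    simp only [BinTree.size, size_encodeNat]
    omega
  have := countdown (K := K) (S := fun _ => BinTree) (fun _ => encodeNat) (fun _ s => s)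
    (fun i k acc => .cons (g i k) acc) (fun _ => .nil)
    (fun i k s => s.size + k * (c i + 1) ≤ K i * (c i + 1) + 1) (fun _ => rfl)
    (fun _ _ => ⟨_, rfl⟩) (fun i => by simp [BinTree.size]; omega)
    (fun i k s h => by
      have := hgc i k
      rw [add_mul] at h
      simp only [BinTree.size]
      omega)
    (.add (.mul hK.polyBounded_nat (.add hcpoly (.const 1))) (.const 1))
    (fun i k s h => le_trans (Nat.le_add_right _ _) h) hK SolvableInPolyTime.nil
    ((hg.pull (fun x : (i : ι) × Fin (K i) × BinTree => ⟨x.1, x.2.1⟩)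
      (SolvableInPolyTime.id.fst.cons SolvableInPolyTime.id.snd.snd)).cons
      SolvableInPolyTime.id.snd.fst)
  exact this.of_eq fun i => (encodeList_ofFn _ _).symm

/-- Access to an entry of a list. -/
lemma get {K : ι → ℕ} {g : ∀ i, Fin (K i) → BinTree} {b : ∀ i, Fin (K i)}
    (hg : SolvableInPolyTime inp fun i => encodeList (List.ofFn (g i)))
    (hb : SolvableInPolyTime inp fun i => encodeNat (b i)) :
    SolvableInPolyTime inp fun i => g i (b i) := by
  have := countdown (K := fun i => (b i : ℕ)) (S := fun _ => BinTree) (fun _ => encodeNat)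
    (fun _ s => s) (fun _ _ s => s.right) (fun i => encodeList (List.ofFn (g i)))
    (fun i _ s => s.size ≤ (encodeList (List.ofFn (g i))).size) (fun _ => rfl)
    (fun _ _ => ⟨_, rfl⟩) (fun _ => le_rfl)
    (fun i _ s h => le_trans (by cases s <;> simp [BinTree.right, BinTree.size]; omega) h)
    hg.polyBounded (fun _ _ _ h => h) hb hg SolvableInPolyTime.id.snd.fst.right
  refine this.left.of_eq fun i => ?_
  rw [fin_foldr_const]
  have key : ∀ (K : ℕ) (g : Fin K → BinTree) (b : Fin K),
      (BinTree.right^[(b : ℕ)] (encodeList (List.ofFn g))).left = g b := by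
    intro K
    induction K with
    | zero => intro _ b; exact b.elim0
    | succ K ih =>
      intro g b
      rw [List.ofFn_succ, encodeList]
      refine Fin.cases ?_ (fun b => ?_) b
      · rfl
      · rw [Fin.val_succ, Function.iterate_succ_apply]
        exact ih (fun k => g k.succ) b
  exact key _ _ _

/-- The length of a list. -/
lemma length {K : ι → ℕ} {g : ∀ i, Fin (K i) → BinTree}
    (hg : SolvableInPolyTime inp fun i => encodeList (List.ofFn (g i))) :
    SolvableInPolyTime inp fun i => encodeNat (K i) := by
  have := countdown (K := K) (S := fun _ => ℕ)
    (fun i k => encodeList ((List.ofFn (g i)).drop (K i - k))) (fun _ => encodeNat)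
    (fun _ _ s => s + 1) (fun _ => 0) (fun i k s => s + k ≤ K i)
    (fun i => by rw [List.drop_of_length_le (by simp)]; rfl)
    (fun i k => by
      have hlt : K i - (k + 1) < (List.ofFn (g i)).length := by
        rw [List.length_ofFn]
        omega
      refine ⟨(List.ofFn (g i))[K i - (k + 1)], ?_⟩
      rw [List.drop_eq_getElem_cons hlt, show K i - (k + 1) + 1 = K i - k by omega]
      rfl)
    (fun i => by simp) (fun i k s h => by omega)
    (B := fun i => 2 * (encodeList (List.ofFn (g i))).size + 1)
    (.add (.mul (.const 2) hg.polyBounded) (.const 1))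
    (fun i k s h => by
      have := length_le_size_encodeList (List.ofFn (g i))
      rw [List.length_ofFn] at this
      rw [size_encodeNat]
      omega)
    (hg.of_eq fun i => by simp) zero SolvableInPolyTime.id.snd.fst.succ
  refine this.of_eq fun i => congrArg encodeNat ?_
  rw [fin_foldr_const]
  induction K i with
  | zero => rfl
  | succ k ih => rw [Function.iterate_succ_apply', ih]

/-- Case distinction for an option. -/
lemma option_elim {K : ι → ℕ} {o : ∀ i, Option (Fin (K i))} {f : ι → BinTree}
    {g : ∀ i, Fin (K i) → BinTree} (ho : SolvableInPolyTime inp fun i => encodeOption (o i))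
    (hf : SolvableInPolyTime inp f)
    (hg : SolvableInPolyTime (ι := (i : ι) × Fin (K i))
      (fun x => .cons (encodeNat x.2) (inp x.1)) fun x => g x.1 x.2) :
    SolvableInPolyTime inp fun i => (o i).elim (f i) (g i) := by
  refine ho.cases ?_ ((hf.reindex _).of_eq fun i => ?_)
  · have hsome : ∀ i : {i // encodeOption (o i) ≠ .nil}, ∃ j, o i.1 = some j := by
      rintro ⟨i, hi⟩
      rcases h : o i with _ | j
      · exact absurd (by rw [h]; rfl) hi
      · exact ⟨j, rfl⟩
    choose j hj using hsome
    refine (hg.pull (fun i : {i // encodeOption (o i) ≠ .nil} => ⟨i.1, j i⟩)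
      (((ho.reindex fun i : {i // encodeOption (o i) ≠ .nil} => i.1).right.of_eq
        fun i => ?_).cons SolvableInPolyTime.id)).of_eq fun i => ?_
    · rw [hj]; rfl
    · rw [hj]; rfl
  · rcases h : o i.1 with _ | j
    · rfl
    · have := i.2
      rw [h] at this
      exact absurd this BinTree.noConfusion

end SolvableInPolyTime

end

/-! ### The egalitarian mechanism in polynomial time -/

section Program

/-- The instances of the mechanism, with represented reports. -/
abbrev PEInstance : Type :=
  (n : {n : ℕ // 2 ≤ n}) × ℕ × Equiv.Perm (Fin n.1) × (Fin n.1 → BinTree)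

/-- The input that encodes an instance. -/
def PEInstance.input (x : PEInstance) : BinTree := encodeInstance x.2.1 x.2.2.1 x.2.2.2

/-- The rank functions of the reports, illegal reports being replaced by zero. -/
def PEInstance.rank (R : Representation) (x : PEInstance) :
    Fin x.1.1 → Finset (Fin x.2.1) → ℕ :=
  fun i => rankOf (legalize (R x.2.1 (x.2.2.2 i)))

/-- The owners of the items, as the list of their codes. -/
def encodeOwner {n m : ℕ} (o : Fin m → Option (Fin n)) : BinTree :=
  encodeList (List.ofFn fun a => encodeOption (o a))

/-- An auction state, as its owners, its prices in unary, and its buyer. -/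
def encodeState {n m : ℕ} (s : AuctionState n m) : BinTree :=
  .cons (encodeOwner s.owner)
    (.cons (encodeList (List.ofFn fun b => encodeNat (s.price b))) (encodeOption s.buyer))

/-- A bound for the sizes of encoded owners. -/
def ownerBound (n m : ℕ) : ℕ := m * (2 * n + 1 + 1) + 1

/-- A bound for the sizes of encoded auction states. -/
def stateBound (n m : ℕ) : ℕ :=
  ownerBound n m + (m * (2 * (m + 1) + 1 + 1) + 1 + (2 * n + 1) + 1) + 1

lemma size_encodeOwner_le {n m : ℕ} (o : Fin m → Option (Fin n)) :
    (encodeOwner o).size ≤ ownerBound n m :=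
  size_encodeList_ofFn_le fun _ => size_encodeOption_le _

lemma size_encodeState_le {n m : ℕ} (s : AuctionState n m) :
    (encodeState s).size ≤ stateBound n m := by
  have h1 := size_encodeOwner_le s.owner
  have h2 : (encodeList (List.ofFn fun b => encodeNat (s.price b))).size ≤
      m * (2 * (m + 1) + 1 + 1) + 1 :=
    size_encodeList_ofFn_le fun b => by
      rw [size_encodeNat]
      omega
  have h3 := size_encodeOption_le s.buyer
  simp only [encodeState, BinTree.size, stateBound]
  omega

variable {κ : Type*} {inp : κ → BinTree}

lemma polyBounded_ownerBound {n m : κ → ℕ} (hn : PolyBounded inp n) (hm : PolyBounded inp m) :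
    PolyBounded inp fun k => ownerBound (n k) (m k) :=
  .add (.mul hm (.add (.add (.mul (.const 2) hn) (.const 1)) (.const 1))) (.const 1)

lemma polyBounded_stateBound {n m : κ → ℕ} (hn : PolyBounded inp n) (hm : PolyBounded inp m) :
    PolyBounded inp fun k => stateBound (n k) (m k) :=
  .add (.add (polyBounded_ownerBound hn hm) (.add (.add (.add (.mul hm
    (.add (.add (.mul (.const 2) (.add hm (.const 1))) (.const 1)) (.const 1))) (.const 1))
    (.add (.mul (.const 2) hn) (.const 1))) (.const 1))) (.const 1)

namespace SolvableInPolyTime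

section General

variable {n m : κ → ℕ}

lemma findItem {P : ∀ k, Fin (m k) → Prop} [∀ k, DecidablePred (P k)]
    {init : ∀ k, Option (Fin (m k))} (hm : SolvableInPolyTime inp fun k => encodeNat (m k))
    (hP : SolvableInPolyTime (ι := (k : κ) × Fin (m k))
      (fun y => .cons (encodeNat y.2) (inp y.1)) fun y => encodeProp (P y.1 y.2))
    (hinit : SolvableInPolyTime inp fun k => encodeOption (init k)) :
    SolvableInPolyTime inp fun k =>
      encodeOption (PrioritizedEgalitarian.findItem (P k) (init k)) := by
  refine foldr (S := fun k => Option (Fin (m k))) (fun _ => encodeOption) _ init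
    (B := fun k => 2 * m k + 1) (.add (.mul (.const 2) hm.polyBounded_nat) (.const 1))
    (fun _ => size_encodeOption_le) hm hinit ?_
  refine (ite (hP.pull (fun y : (k : κ) × Fin (m k) × Option (Fin (m k)) => ⟨y.1, y.2.1⟩)
    (SolvableInPolyTime.id.fst.cons SolvableInPolyTime.id.snd.snd))
    SolvableInPolyTime.id.fst.succ SolvableInPolyTime.id.snd.fst).of_eq fun y => ?_
  by_cases h : P y.1 y.2.1
  · rw [if_pos h, if_pos h]; rfl
  · rw [if_neg h, if_neg h]

lemma bundleOf {o : ∀ k, Fin (m k) → Option (Fin (n k))} {j : ∀ k, Fin (n k)}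
    (hm : SolvableInPolyTime inp fun k => encodeNat (m k))
    (ho : SolvableInPolyTime inp fun k => encodeOwner (o k))
    (hj : SolvableInPolyTime inp fun k => encodeNat (j k)) :
    SolvableInPolyTime inp fun k => encodeItems (PrioritizedEgalitarian.bundleOf (o k) (j k)) := by
  refine ofFn hm ?_
  refine (SolvableInPolyTime.eq (a := fun y : (k : κ) × Fin (m k) => optionCode (o y.1 y.2))
    (b := fun y => (j y.1 : ℕ) + 1)
    ((ho.pull (fun y : (k : κ) × Fin (m k) => y.1) SolvableInPolyTime.id.snd).get
      SolvableInPolyTime.id.fst)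
    (hj.pull (fun y : (k : κ) × Fin (m k) => y.1) SolvableInPolyTime.id.snd).succ).of_eq
    fun y => congrArg encodeProp ?_
  rw [optionCode_eq_iff, mem_bundleOf]

lemma insertItem {T : ∀ k, Finset (Fin (m k))} {b : ∀ k, Fin (m k)}
    (hm : SolvableInPolyTime inp fun k => encodeNat (m k))
    (hT : SolvableInPolyTime inp fun k => encodeItems (T k))
    (hb : SolvableInPolyTime inp fun k => encodeNat (b k)) :
    SolvableInPolyTime inp fun k => encodeItems (insert (b k) (T k)) := by
  refine ofFn hm ?_
  refine (or (P := fun y : (k : κ) × Fin (m k) => (y.2 : ℕ) = b y.1) (Q := fun y => y.2 ∈ T y.1)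
    (SolvableInPolyTime.eq SolvableInPolyTime.id.fst
      (hb.pull (fun y : (k : κ) × Fin (m k) => y.1) SolvableInPolyTime.id.snd))
    ((hT.pull (fun y : (k : κ) × Fin (m k) => y.1) SolvableInPolyTime.id.snd).get
      SolvableInPolyTime.id.fst)).of_eq
    fun y => congrArg encodeProp ?_
  rw [Finset.mem_insert, Fin.ext_iff]

lemma sell {s : ∀ k, AuctionState (n k) (m k)} {j : ∀ k, Fin (n k)} {b : ∀ k, Fin (m k)}
    (hm : SolvableInPolyTime inp fun k => encodeNat (m k))
    (hs : SolvableInPolyTime inp fun k => encodeState (s k))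
    (hj : SolvableInPolyTime inp fun k => encodeNat (j k))
    (hb : SolvableInPolyTime inp fun k => encodeNat (b k)) :
    SolvableInPolyTime inp fun k => encodeState ((s k).sell (j k) (b k)) := by
  have hc := hb.pull (fun y : (k : κ) × Fin (m k) => y.1)
    (inp' := fun y => .cons (encodeNat y.2) (inp y.1)) SolvableInPolyTime.id.snd
  have htest := SolvableInPolyTime.eq (a := fun y : (k : κ) × Fin (m k) => (y.2 : ℕ))
    SolvableInPolyTime.id.fst hc
  have hm' := hm.pull (fun y : (k : κ) × Fin (m k) => y.1)
    (inp' := fun y => .cons (encodeNat y.2) (inp y.1)) SolvableInPolyTime.id.snd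
  have hp := (hs.snd.fst.pull (fun y : (k : κ) × Fin (m k) => y.1)
    (inp' := fun y => .cons (encodeNat y.2) (inp y.1)) SolvableInPolyTime.id.snd).get
    SolvableInPolyTime.id.fst
  refine (SolvableInPolyTime.cons (ofFn hm ?_) (.cons (ofFn hm ?_) (hs.fst.get hb)))
  · refine (ite htest (hj.pull (fun y : (k : κ) × Fin (m k) => y.1) SolvableInPolyTime.id.snd).succ
      ((hs.fst.pull (fun y : (k : κ) × Fin (m k) => y.1) SolvableInPolyTime.id.snd).get
        SolvableInPolyTime.id.fst)).of_eq fun y => ?_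
    by_cases h : y.2 = b y.1
    · rw [if_pos (congrArg Fin.val h), h]
      simp [AuctionState.sell, encodeOption, optionCode]
    · rw [if_neg fun e => h (Fin.ext e)]
      simp [AuctionState.sell, h]
  · refine (ite htest (hp.succ.sub (hp.succ.sub hm'.succ)) hp).of_eq fun y => ?_
    by_cases h : y.2 = b y.1
    · rw [if_pos (congrArg Fin.val h), ← h]
      simp only [AuctionState.sell, Function.update_self, raise]
      congr 1
      omega
    · rw [if_neg fun e => h (Fin.ext e)]
      simp [AuctionState.sell, h]

end General

variable {x : κ → PEInstance}

lemma items (hx : SolvableInPolyTime inp fun k => (x k).input) :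
    SolvableInPolyTime inp fun k => encodeNat (x k).2.1 := hx.fst

lemma agents (hx : SolvableInPolyTime inp fun k => (x k).input) :
    SolvableInPolyTime inp fun k => encodeNat (x k).1.1 := hx.snd.snd.length

variable {R : Representation} {j : ∀ k, Fin (x k).1.1} {o : ∀ k, Fin (x k).2.1 → Option (Fin (x k).1.1)}

lemma rank (hR : IsSuccinct R) (hx : SolvableInPolyTime inp fun k => (x k).input)
    {T : ∀ k, Finset (Fin (x k).2.1)} (hj : SolvableInPolyTime inp fun k => encodeNat (j k))
    (hT : SolvableInPolyTime inp fun k => encodeItems (T k)) :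
    SolvableInPolyTime inp fun k => encodeNat ((x k).rank R (j k) (T k)) := by
  have hd : SolvableInPolyTime inp fun k => (x k).2.2.2 (j k) := hx.snd.snd.get hj
  refine (hR.2.pull (fun k => ((x k).2.1, (x k).2.2.2 (j k))) (hx.items.cons hd)).prop_cases ?_ ?_
  · refine (hR.1.pull (fun k : {k // IsSubmodularDichotomous (R (x k).2.1 ((x k).2.2.2 (j k)))} =>
      ⟨⟨(x k).2.1, (x k).2.2.2 (j k), T k⟩, k.2⟩)
      ((hx.items.cons (hd.cons hT)).reindex Subtype.val)).of_eq fun k => ?_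
    simp only [PEInstance.rank, rankOf, legalize_eq_self k.2]
  · refine SolvableInPolyTime.nil.of_eq fun k => ?_
    simp [PEInstance.rank, rankOf, legalize, k.2, encodeNat]

lemma isUseful (hR : IsSuccinct R) (hx : SolvableInPolyTime inp fun k => (x k).input)
    {b : ∀ k, Fin (x k).2.1} (ho : SolvableInPolyTime inp fun k => encodeOwner (o k))
    (hj : SolvableInPolyTime inp fun k => encodeNat (j k))
    (hb : SolvableInPolyTime inp fun k => encodeNat (b k)) :
    SolvableInPolyTime inp fun k => encodeProp (IsUseful ((x k).rank R) (o k) (j k) (b k)) :=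
  (rank hR hx hj (bundleOf hx.items ho hj)).lt
    (rank hR hx hj (insertItem hx.items (bundleOf hx.items ho hj) hb))

variable {s : ∀ k, AuctionState (x k).1.1 (x k).2.1}

lemma cheapest (hR : IsSuccinct R) (hx : SolvableInPolyTime inp fun k => (x k).input)
    (hs : SolvableInPolyTime inp fun k => encodeState (s k))
    (hj : SolvableInPolyTime inp fun k => encodeNat (j k)) :
    SolvableInPolyTime inp fun k =>
      encodeOption (PrioritizedEgalitarian.cheapest ((x k).rank R) (s k) (j k)) := by
  refine foldr (K := fun k => (x k).2.1 + 1) (S := fun k => Option (Fin (x k).2.1))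
    (fun _ => encodeOption) _ (fun _ => none) (B := fun k => 2 * (x k).2.1 + 1)
    (.add (.mul (.const 2) hx.items.polyBounded_nat) (.const 1))
    (fun _ => size_encodeOption_le) hx.items.succ zero ?_
  refine findItem (hx.items.pull _ SolvableInPolyTime.id.snd.snd) ?_ SolvableInPolyTime.id.snd.fst
  have hs' := hs.pull (fun y : (y : (k : κ) × Fin ((x k).2.1 + 1) × Option (Fin (x k).2.1)) ×
      Fin (x y.1).2.1 => y.1.1) (inp' := fun y => .cons (encodeNat y.2)
      (.cons (encodeNat y.1.2.1) (.cons (encodeOption y.1.2.2) (inp y.1.1))))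
    SolvableInPolyTime.id.snd.snd.snd
  exact and
    (isUseful hR (hx.pull _ SolvableInPolyTime.id.snd.snd.snd) hs'.fst
      (hj.pull _ SolvableInPolyTime.id.snd.snd.snd) SolvableInPolyTime.id.fst)
    (SolvableInPolyTime.eq (hs'.snd.fst.get SolvableInPolyTime.id.fst)
      SolvableInPolyTime.id.snd.fst)

lemma step (hR : IsSuccinct R) (hx : SolvableInPolyTime inp fun k => (x k).input)
    (hs : SolvableInPolyTime inp fun k => encodeState (s k)) :
    SolvableInPolyTime inp fun k => encodeState ((s k).step ((x k).rank R)) := by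
  refine (option_elim (o := fun k => (s k).buyer) (f := fun k => encodeState (s k))
    (g := fun k j => (PrioritizedEgalitarian.cheapest ((x k).rank R) (s k) j).elim
      (encodeState (s k)) fun b => encodeState ((s k).sell j b)) hs.snd.snd hs ?_).of_eq
    fun k => ?_
  · refine option_elim (cheapest hR (hx.pull _ SolvableInPolyTime.id.snd)
      (hs.pull _ SolvableInPolyTime.id.snd) SolvableInPolyTime.id.fst)
      (hs.pull _ SolvableInPolyTime.id.snd) ?_
    exact sell (hx.items.pull _ SolvableInPolyTime.id.snd.snd)
      (hs.pull _ SolvableInPolyTime.id.snd.snd)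
      SolvableInPolyTime.id.snd.fst SolvableInPolyTime.id.fst
  · unfold AuctionState.step
    rcases (s k).buyer with _ | j
    · rfl
    · simp only [Option.elim_some]
      cases PrioritizedEgalitarian.cheapest ((x k).rank R) (s k) j <;> rfl

lemma auction (hR : IsSuccinct R) (hx : SolvableInPolyTime inp fun k => (x k).input)
    (ho : SolvableInPolyTime inp fun k => encodeOwner (o k))
    (hj : SolvableInPolyTime inp fun k => encodeNat (j k)) :
    SolvableInPolyTime inp fun k =>
      encodeState (PrioritizedEgalitarian.auction ((x k).rank R) (o k) (j k)) := by
  have hstart : SolvableInPolyTime inp fun k => encodeState (auctionStart (o k) (j k)) :=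
    ho.cons ((ofFn hx.items zero).cons hj.succ)
  refine foldr (K := fun k => (x k).2.1 + 1)
    (S := fun k => AuctionState (x k).1.1 (x k).2.1) (fun _ => encodeState) _ _
    (polyBounded_stateBound hx.agents.polyBounded_nat hx.items.polyBounded_nat)
    (fun _ => size_encodeState_le) hx.items.succ hstart ?_
  have hx' := hx.pull (fun y : (k : κ) × Fin ((x k).2.1 + 1) × AuctionState (x k).1.1 (x k).2.1 =>
      y.1) (inp' := fun y => .cons (encodeNat y.2.1) (.cons (encodeState y.2.2) (inp y.1)))
    SolvableInPolyTime.id.snd.snd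
  refine foldr (K := fun y : (k : κ) × Fin ((x k).2.1 + 1) × AuctionState (x k).1.1 (x k).2.1 =>
      (x y.1).2.1 + 1)
    (S := fun y => AuctionState (x y.1).1.1 (x y.1).2.1) (fun _ => encodeState)
    (fun y _ s => s.step ((x y.1).rank R)) (fun y => y.2.2)
    (polyBounded_stateBound hx'.agents.polyBounded_nat hx'.items.polyBounded_nat)
    (fun _ => size_encodeState_le) hx'.items.succ SolvableInPolyTime.id.snd.fst ?_
  exact step hR (hx'.pull _ SolvableInPolyTime.id.snd.snd) SolvableInPolyTime.id.snd.fst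

lemma augmentAgent (hR : IsSuccinct R) (hx : SolvableInPolyTime inp fun k => (x k).input)
    (ho : SolvableInPolyTime inp fun k => encodeOwner (o k))
    (hj : SolvableInPolyTime inp fun k => encodeNat (j k)) :
    SolvableInPolyTime inp fun k =>
      encodeOwner (PrioritizedEgalitarian.augmentAgent ((x k).rank R) (j k) (o k)) := by
  have ha := auction hR hx ho hj
  refine (ite (P := fun k => (PrioritizedEgalitarian.auction ((x k).rank R) (o k) (j k)).buyer = none)
    (ha.snd.snd.of_test fun k => ?_) ha.fst ho).of_eq fun k => ?_
  · rw [encodeOption, ← optionCode_eq_zero]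
    cases optionCode (PrioritizedEgalitarian.auction ((x k).rank R) (o k) (j k)).buyer <;>
      simp [encodeNat]
  · unfold PrioritizedEgalitarian.augmentAgent
    split_ifs <;> rfl

lemma egalitarianRound (hR : IsSuccinct R) (hx : SolvableInPolyTime inp fun k => (x k).input)
    (ho : SolvableInPolyTime inp fun k => encodeOwner (o k)) :
    SolvableInPolyTime inp fun k =>
      encodeOwner (PrioritizedEgalitarian.egalitarianRound (x k).2.2.1 ((x k).rank R) (o k)) := by
  refine foldr (K := fun k => (x k).1.1) (S := fun k => Fin (x k).2.1 → Option (Fin (x k).1.1))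
    (fun _ => encodeOwner) _ _
    (polyBounded_ownerBound hx.agents.polyBounded_nat hx.items.polyBounded_nat)
    (fun _ => size_encodeOwner_le) hx.agents ho ?_
  have hx' := hx.pull (fun y : (k : κ) × Fin (x k).1.1 × (Fin (x k).2.1 → Option (Fin (x k).1.1)) =>
      y.1) (inp' := fun y => .cons (encodeNat y.2.1) (.cons (encodeOwner y.2.2) (inp y.1)))
    SolvableInPolyTime.id.snd.snd
  refine foldr (K := fun y : (k : κ) × Fin (x k).1.1 ×
      (Fin (x k).2.1 → Option (Fin (x k).1.1)) => (x y.1).1.1)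
    (S := fun y => Fin (x y.1).2.1 → Option (Fin (x y.1).1.1)) (fun _ => encodeOwner)
    (fun y i o => if ((x y.1).2.2.1 i : ℕ) = (x y.1).1.1 - (y.2.1 + 1) then
      PrioritizedEgalitarian.augmentAgent ((x y.1).rank R) i o else o) (fun y => y.2.2)
    (polyBounded_ownerBound hx'.agents.polyBounded_nat hx'.items.polyBounded_nat)
    (fun _ => size_encodeOwner_le) hx'.agents SolvableInPolyTime.id.snd.fst ?_
  have hx'' := hx'.pull (fun z : (y : (k : κ) × Fin (x k).1.1 ×
      (Fin (x k).2.1 → Option (Fin (x k).1.1))) × Fin (x y.1).1.1 ×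
      (Fin (x y.1).2.1 → Option (Fin (x y.1).1.1)) => z.1)
    (inp' := fun z => .cons (encodeNat z.2.1) (.cons (encodeOwner z.2.2)
      (.cons (encodeNat z.1.2.1) (.cons (encodeOwner z.1.2.2) (inp z.1.1)))))
    SolvableInPolyTime.id.snd.snd
  refine (ite (SolvableInPolyTime.eq (hx''.snd.fst.get SolvableInPolyTime.id.fst)
    (hx''.agents.sub SolvableInPolyTime.id.snd.snd.fst.succ))
    (augmentAgent hR hx'' SolvableInPolyTime.id.snd.fst SolvableInPolyTime.id.fst)
    SolvableInPolyTime.id.snd.fst).of_eq fun z => ?_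
  split_ifs <;> rfl

lemma egalitarianOwner (hR : IsSuccinct R) (hx : SolvableInPolyTime inp fun k => (x k).input) :
    SolvableInPolyTime inp fun k =>
      encodeOwner (PrioritizedEgalitarian.egalitarianOwner (x k).2.2.1 ((x k).rank R)) := by
  have hstart : SolvableInPolyTime inp fun k =>
      encodeOwner (fun _ => none : Fin (x k).2.1 → Option (Fin (x k).1.1)) := ofFn hx.items zero
  refine foldr (K := fun k => (x k).2.1 + 1)
    (S := fun k => Fin (x k).2.1 → Option (Fin (x k).1.1)) (fun _ => encodeOwner) _ _
    (polyBounded_ownerBound hx.agents.polyBounded_nat hx.items.polyBounded_nat)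
    (fun _ => size_encodeOwner_le) hx.items.succ hstart ?_
  exact egalitarianRound hR (hx.pull _ SolvableInPolyTime.id.snd.snd) SolvableInPolyTime.id.snd.fst

end SolvableInPolyTime

/-- The mechanism that replaces illegal reports by zero and computes the egalitarian allocation. -/
def egalitarianMechanism (n m : ℕ) (σ : Equiv.Perm (Fin n)) : Mechanism n (Fin m) :=
  fun r => egalitarianAllocation σ fun i => legalize (r i)

lemma isPEMechanism_egalitarianMechanism {n : ℕ} (m : ℕ) (hn : 2 ≤ n) (σ : Equiv.Perm (Fin n)) :
    IsPEMechanism σ (egalitarianMechanism n m σ) := fun _ =>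
  isPEAllocation_egalitarianAllocation hn fun _ => isSubmodularDichotomous_legalize _

lemma isPolyTimeMechanism_egalitarianMechanism {R : Representation} (hR : IsSuccinct R) :
    IsPolyTimeMechanism R egalitarianMechanism := by
  have hx : SolvableInPolyTime (fun x : PEInstance => x.input) fun x => x.input :=
    SolvableInPolyTime.id
  exact SolvableInPolyTime.ofFn hx.agents (SolvableInPolyTime.bundleOf
    (hx.items.pull _ SolvableInPolyTime.id.snd)
    ((SolvableInPolyTime.egalitarianOwner hR hx).pull _ SolvableInPolyTime.id.snd)
    SolvableInPolyTime.id.fst)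

end Program

end PrioritizedEgalitarian

end

open PrioritizedEgalitarian in
theorem theorem3p1 :
    (∀ (n m : ℕ), 2 ≤ n → ∀ σ : Equiv.Perm (Fin n),
      (∃ M : Mechanism n (Fin m), IsPEMechanism σ M) ∧
      ∀ M : Mechanism n (Fin m), IsPEMechanism σ M →
        IsTruthful M ∧
        ∀ f : Fin n → Valuation (Fin m), (∀ i, IsSubmodularDichotomous (f i)) →
          IsNonRedundant f (M f) ∧
          IsWelfareMaximizing f (M f) ∧
          IsLorenzDominating f (M f) ∧
          IsLexMin f (M f) ∧
          IsMinSquare f (M f) ∧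
          IsNSWMaximizing f (M f) ∧
          IsEFX f (M f) ∧
          IsEF1 f (M f) ∧
          ((∀ i, IsAdditive (f i)) → IsMaximinFair f (M f))) ∧
    ∃ M : (n m : ℕ) → Equiv.Perm (Fin n) → Mechanism n (Fin m),
      (∀ (n m : ℕ), 2 ≤ n → ∀ σ : Equiv.Perm (Fin n), IsPEMechanism σ (M n m σ)) ∧
      ∀ R : Representation, IsSuccinct R → IsPolyTimeMechanism R M := by
  refine ⟨fun n m hn σ => ⟨⟨_, isPEMechanism_egalitarianMechanism m hn σ⟩, fun M hM =>
    ⟨hM.isTruthful hn, fun f hf => ?_⟩⟩, egalitarianMechanism,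
    fun n m hn σ => isPEMechanism_egalitarianMechanism m hn σ,
    fun R hR => isPolyTimeMechanism_egalitarianMechanism hR⟩
  have hPE : IsPEAllocation σ f (M f) := by
    have := hM f
    rwa [funext fun i => legalize_eq_self (hf i)] at this
  have hE := hPE.isEgalitarian hn hf
  have hW := isWelfareMaximizing_of_isEgalitarian hf hE
  have hL := isLorenzDominating_of_isEgalitarian hf hE
  have hS := isMinSquare_of_isEgalitarian hf hE
  have hX := hS.isEFX hf hPE.1
  exact ⟨hPE.1, hW, hL, fun B => (hL B).lexMinGT_or_eq, hS, isNSWMaximizing_of_isEgalitarian hf hE,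
    hX, hX.isEF1 hf, fun hadd => hX.isMaximinFair hf hadd hW⟩
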